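/- Let $a,b\in\mathbb R$ and let $\mu$ be a probability measure on $[a,b]$ with infinitely many points of increase (i.e. with infinite support), and let $$\varphi(z)=\int_a^b\frac{d\mu(t)}{z-t}.$$ Let $z_1,z_2,\dots\in\mathbb C\setminus[a,b]$ satisfy $z_{2j+1}=\overline{z_{2j+2}}$ for $j\ge 0$, $\operatorname{dist}(z_j,[a,b])>\delta$ for all $j\ge1$ and some $\delta>0$, and $z_{2j+1}=\overline{z_{2j+2}}\to\infty$ as $j\to\infty$. Expand $\varphi$ into the associated continued fraction as follows. There exist probability measures $\mu_0=\mu,\mu_1,\mu_2,\dots$ on $[a,b]$ such that, with $\varphi_j(z)=\int_a^b\frac{d\mu_j(t)}{z-t}$, for all $j\ge0$ and $z\in\mathbb C\setminus[a,b]$, $$\varphi_j(z)=\frac{1}{zB_{j,j}-A_{j,j}-B_{j+1,j}^2(z-z_{2j+1})(z-z_{2j+2})\varphi_{j+1}(z)},\qquad(*)$$ where $$B_{j,j}=\frac{\int_a^b|z_{2j+1}-t|^{-2}\,d\mu_j(t)}{|\varphi_j(z_{2j+1})|^2},\quad A_{j,j}=\frac{\int_a^b t\,|z_{2j+1}-t|^{-2}\,d\mu_j(t)}{|\varphi_j(z_{2j+1})|^2},\quad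 B_{j+1,j}=\sqrt{B_{j,j}-1}.$$ For any such measures, let $A=(A_{j,k})_{j,k\ge0}$ and $B=(B_{j,k})_{j,k\ge0}$ be the infinite tridiagonal matrices with these diagonal entries and with $B_{j,j+1}=B_{j+1,j}=\sqrt{B_{j,j}-1}$, $A_{j+1,j}=B_{j+1,j}z_{2j+1}$, $A_{j,j+1}=B_{j,j+1}z_{2j+2}$, all other entries being $0$. Then $A$ and $B$ act by the matrix product as bounded operators on $\ell^2=\ell^2_{[0:\infty)}$, and: 1. $B-I$ is compact, and $0\notin\overline{\Theta(B)}$, where $\Theta(B)=\{\langle By,y\rangle:\|y\|=1\}$ is the numerical range of $B$; 2. the spectrum $\sigma(A,B)$ of the pencil $zB-A$, that is, the set of $z\in\mathbb C$ for which $zB-A$ has no bounded inverse on $\ell^2$, equals $\operatorname{supp}\mu$; 3. for all $z\in\mathbb C\setminus\sigma(A,B)$ one has $\varphi(z)=m(z)$, where $m(z)=\langle(zB-A)^{-1}e_0,e_0\rangle$ and $e_0=(1,0,0,\dots)^\top$. -/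

import Mathlib

open MeasureTheory Filter Topology

noncomputable section

namespace MarkovPencil

/-- The Hilbert space of complex square summable sequences indexed by `0, 1, 2, …`. -/
abbrev Ell2 : Type := lp (fun _ : ℕ => ℂ) 2

/-- The canonical basis vectors of `Ell2`. -/
def e (k : ℕ) : Ell2 := lp.single 2 k (1 : ℂ)

/-- The bounded operator `T` acts on sequences by the usual matrix product with the infinite
matrix `M`. Such a `T` is unique if it exists. -/
def Represents (T : Ell2 →L[ℂ] Ell2) (M : Matrix ℕ ℕ ℂ) : Prop :=
  ∀ (x : Ell2) (i : ℕ), HasSum (fun j => M i j * x j) (T x i)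

/-- The numerical range `Θ(T)`. Mathlib's inner product is conjugate linear in its first
argument, so `inner ℂ y (T y)` is what is usually written `⟨T y, y⟩`. -/
def numericalRange (T : Ell2 →L[ℂ] Ell2) : Set ℂ :=
  {c | ∃ y : Ell2, ‖y‖ = 1 ∧ inner ℂ y (T y) = c}

/-- The resolvent set `ρ(A, B)` of the pencil `z B - A`: the points where it has a bounded
inverse. -/
def pencilResolventSet (A B : Ell2 →L[ℂ] Ell2) : Set ℂ := {z | IsUnit (z • B - A)}

/-- The spectrum `σ(A, B)` of the pencil `z B - A`. -/
def pencilSpectrum (A B : Ell2 →L[ℂ] Ell2) : Set ℂ := (pencilResolventSet A B)ᶜ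

/-- The `m`-function `⟨(z B - A)⁻¹ e₀, e₀⟩`, meaningful for `z` in the resolvent set. -/
def mFunction (A B : Ell2 →L[ℂ] Ell2) (z : ℂ) : ℂ :=
  inner ℂ (e 0) (Ring.inverse (z • B - A) (e 0))

/-- The real interval `[a, b]` as a subset of the complex plane. -/
def cSegment (a b : ℝ) : Set ℂ := (fun t : ℝ => (t : ℂ)) '' Set.Icc a b

/-- The Markov function `φ(z) = ∫ dμ(t) / (z - t)`. -/
def markov (μ : Measure ℝ) (z : ℂ) : ℂ := ∫ t : ℝ, 1 / (z - (t : ℂ)) ∂μ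

/-- `(∫ dν(t) / |w - t|²) / |∫ dν(t) / (w - t)|²`. -/
def diagB (ν : Measure ℝ) (w : ℂ) : ℝ :=
  (∫ t : ℝ, 1 / ‖w - (t : ℂ)‖ ^ 2 ∂ν) / ‖markov ν w‖ ^ 2

/-- `(∫ t dν(t) / |w - t|²) / |∫ dν(t) / (w - t)|²`. -/
def diagA (ν : Measure ℝ) (w : ℂ) : ℝ :=
  (∫ t : ℝ, t / ‖w - (t : ℂ)‖ ^ 2 ∂ν) / ‖markov ν w‖ ^ 2

/-- `√(diagB - 1)`. -/
def offB (ν : Measure ℝ) (w : ℂ) : ℝ := Real.sqrt (diagB ν w - 1)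

/-- `ν 0, ν 1, …` are probability measures on `[a, b]`, starting with `μ`, whose Markov functions
are the successive tails of the continued fraction expansion of the Markov function of `μ` with
interpolation points `z 1, z 2, …` (the value `z 0` is not used):
`φ_j(ζ) = 1 / (ζ B_{j,j} - A_{j,j} - B_{j+1,j}² (ζ - z_{2j+1}) (ζ - z_{2j+2}) φ_{j+1}(ζ))`. -/
structure IsThieleExpansion (a b : ℝ) (μ : Measure ℝ) (z : ℕ → ℂ) (ν : ℕ → Measure ℝ) :
    Prop where
  zero : ν 0 = μ
  isProbability : ∀ j, IsProbabilityMeasure (ν j)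
  supported : ∀ j, ν j (Set.Icc a b)ᶜ = 0
  recurrence : ∀ j, ∀ ζ : ℂ, ζ ∉ cSegment a b →
    markov (ν j) ζ =
      1 / (ζ * (diagB (ν j) (z (2 * j + 1)) : ℂ) - (diagA (ν j) (z (2 * j + 1)) : ℂ)
        - (offB (ν j) (z (2 * j + 1)) : ℂ) ^ 2 * (ζ - z (2 * j + 1)) * (ζ - z (2 * j + 2))
          * markov (ν (j + 1)) ζ)

/-- The infinite tridiagonal real symmetric matrix `B`. -/
def matB (z : ℕ → ℂ) (ν : ℕ → Measure ℝ) : Matrix ℕ ℕ ℂ := fun i j =>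
  if i = j then (diagB (ν j) (z (2 * j + 1)) : ℂ)
  else if i = j + 1 then (offB (ν j) (z (2 * j + 1)) : ℂ)
  else if j = i + 1 then (offB (ν i) (z (2 * i + 1)) : ℂ)
  else 0

/-- The infinite tridiagonal matrix `A`, with `A_{j+1,j} = B_{j+1,j} z_{2j+1}` and
`A_{j,j+1} = B_{j,j+1} z_{2j+2}`. -/
def matA (z : ℕ → ℂ) (ν : ℕ → Measure ℝ) : Matrix ℕ ℕ ℂ := fun i j =>
  if i = j then (diagA (ν j) (z (2 * j + 1)) : ℂ)
  else if i = j + 1 then (offB (ν j) (z (2 * j + 1)) : ℂ) * z (2 * j + 1)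
  else if j = i + 1 then (offB (ν i) (z (2 * i + 1)) : ℂ) * z (2 * i + 2)
  else 0

end MarkovPencil

end

/-!
The Markov function expansion is the shadow of an operator model. On `L²(ν)` let `T` be
multiplication by `t` (`posOp`) and let `1` be the constant function (`one`), which is cyclic for
`T` by the Weierstrass theorem (`eq_top_of_invariant`). For `w` off `[a, b]` put
`r = (w - t)⁻¹ / φ(w)` (`resVec`). Then `⟨r, 1⟩ = 1`, `‖r‖² = diagB`, `⟨T r, r⟩ = diagA`, and hence
`r = 1 + b q` with `b = offB` and `q` a unit vector orthogonal to `1`. The next measure `ν'` is the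
spectral measure at `q` of the compression of `T` to the orthogonal complement of `1`: it comes with
an isometry `J : L²(ν') → L²(ν)` mapping `1` to `q` (`IsStep`, `exists_isStep`), and a Schur
complement computation gives the continued fraction recurrence (`IsStep.recurrence`). Spectral
measures are obtained from the continuous functional calculus and the Riesz–Markov–Kakutani theorem.
Infinite support means that `L²(μ)` is infinite-dimensional; this passes to each `ν'` and keeps
`b ≠ 0`, so that the recurrence determines the Markov function of `ν'`, hence its moments, hence
`ν'`. Therefore every expansion arises in this way (`exists_isStep_of_recurrence`).

Composing the isometries gives an orthonormal sequence `q₀ = 1, q₁, q₂, …` in `L²(μ)` (`ratVec`), an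
isometry `U` of `ℓ²` into `L²(μ)` mapping `e j` to `q j`, and the lower bidiagonal operator `L` with
`L e j = e j + b j e (j + 1)`, for which `U L e j = r j`. The entries of the two matrices are
`B i j = ⟨L e j, L e i⟩` and `A i j = ⟨T r j, r i⟩`, so that `B = L† L` and `A = L† U† T U L`; in
particular both are bounded. As the interpolation points tend to infinity, `b j → 0` (`offB_le`), so
`L` is an injective compact perturbation of the identity, hence invertible by the Fredholm
alternative. This gives the compactness of `B - 1` and the lower bound on the numerical range.
Moreover `t r j` lies in the span of `q₀, …, q_{j+1}`, so the range of `U`, which is closed and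
equal to the range of `U L`, is invariant under `T` and contains `1`: thus `U` is unitary
(`surjective_of_isUnit`). Finally `z B - A = L† U† (z - T) U L` is invertible exactly when `z - T`
is, that is, off the support of `μ`, and `L† e 0 = e 0` turns the `m`-function into
`⟨(z - T)⁻¹ 1, 1⟩ = φ(z)` (`exists_pencil`).
-/

namespace MarkovPencil

open scoped ENNReal InnerProductSpace ComplexConjugate

/-! ### Multiplication operators on `L²(ν)` -/

section

/-- The operator of multiplication by `f` on `L²(ν)`; it is `0` unless `f` is essentially
bounded. -/
noncomputable def mulOp (ν : Measure ℝ) (f : ℝ → ℂ) : Lp ℂ 2 ν →L[ℂ] Lp ℂ 2 ν :=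
  open Classical in
  if h : MemLp f ∞ ν then (ContinuousLinearMap.mul ℂ ℂ).holderL ν ∞ 2 2 h.toLp else 0

/-- Multiplication by the independent variable on `L²(ν)`. -/
noncomputable abbrev posOp (ν : Measure ℝ) : Lp ℂ 2 ν →L[ℂ] Lp ℂ 2 ν :=
  mulOp ν fun t => (t : ℂ)

/-- The constant function `1` as an element of `L²(ν)`. -/
noncomputable def one (ν : Measure ℝ) [IsFiniteMeasure ν] : Lp ℂ 2 ν :=
  (memLp_const (1 : ℂ)).toLp

variable {ν : Measure ℝ}

lemma mulOp_apply_ae {f : ℝ → ℂ} (hf : MemLp f ∞ ν) (g : Lp ℂ 2 ν) :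
    mulOp ν f g =ᵐ[ν] fun t => f t * g t := by
  rw [mulOp, dif_pos hf]
  filter_upwards [(ContinuousLinearMap.mul ℂ ℂ).coeFn_holder (r := 2) hf.toLp g,
    hf.coeFn_toLp] with t h1 h2
  simpa [h2] using h1

lemma mulOp_congr_ae {f g : ℝ → ℂ} (hf : MemLp f ∞ ν) (h : f =ᵐ[ν] g) :
    mulOp ν f = mulOp ν g := by
  ext1 x
  refine Lp.ext ?_
  filter_upwards [mulOp_apply_ae hf x, mulOp_apply_ae ((memLp_congr_ae h).1 hf) x, h]
    with t h1 h2 h3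
  rw [h1, h2, h3]

lemma mulOp_mul {f g : ℝ → ℂ} (hf : MemLp f ∞ ν) (hg : MemLp g ∞ ν) :
    mulOp ν f * mulOp ν g = mulOp ν (fun t => f t * g t) := by
  have hfg : MemLp (fun t => f t * g t) ∞ ν := hg.mul' hf
  ext1 x
  refine Lp.ext ?_
  filter_upwards [mulOp_apply_ae hf (mulOp ν g x), mulOp_apply_ae hg x, mulOp_apply_ae hfg x]
    with t h1 h2 h3
  rw [mul_apply_eq_comp, h1, h2, h3, mul_assoc]

lemma mulOp_add {f g : ℝ → ℂ} (hf : MemLp f ∞ ν) (hg : MemLp g ∞ ν) :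
    mulOp ν f + mulOp ν g = mulOp ν (fun t => f t + g t) := by
  have hfg : MemLp (fun t => f t + g t) ∞ ν := hf.add hg
  ext1 x
  refine Lp.ext ?_
  filter_upwards [mulOp_apply_ae hf x, mulOp_apply_ae hg x, mulOp_apply_ae hfg x,
    Lp.coeFn_add (mulOp ν f x) (mulOp ν g x)] with t h1 h2 h3 h4
  rw [_root_.add_apply, h4, h3, Pi.add_apply, h1, h2, add_mul]

lemma mulOp_const [IsFiniteMeasure ν] (c : ℂ) : mulOp ν (fun _ => c) = c • 1 := by
  ext1 x
  refine Lp.ext ?_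
  filter_upwards [mulOp_apply_ae (memLp_const c) x, Lp.coeFn_smul c x] with t h1 h2
  rw [h1]
  simp [h2]

lemma mulOp_one_ae [IsFiniteMeasure ν] {f : ℝ → ℂ} (hf : MemLp f ∞ ν) :
    mulOp ν f (one ν) =ᵐ[ν] f := by
  filter_upwards [mulOp_apply_ae hf (one ν), (memLp_const (1 : ℂ) (μ := ν)).coeFn_toLp]
    with t h1 h2
  rw [h1, one, h2, mul_one]

lemma inner_mulOp_left {f : ℝ → ℂ} (hf : MemLp f ∞ ν) (x y : Lp ℂ 2 ν) :
    ⟪mulOp ν f x, y⟫_ℂ = ⟪x, mulOp ν (fun t => conj (f t)) y⟫_ℂ := by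
  rw [L2.inner_def, L2.inner_def]
  have hf' : MemLp (fun t => conj (f t)) ∞ ν := hf.star
  refine integral_congr_ae ?_
  filter_upwards [mulOp_apply_ae hf x, mulOp_apply_ae hf' y] with t h1 h2
  rw [h1, h2]
  simp only [RCLike.inner_apply, map_mul]
  ring

lemma inner_mulOp_one [IsFiniteMeasure ν] {f g : ℝ → ℂ} (hf : MemLp f ∞ ν) (hg : MemLp g ∞ ν) :
    ⟪mulOp ν f (one ν), mulOp ν g (one ν)⟫_ℂ = ∫ t, conj (f t) * g t ∂ν := by
  rw [L2.inner_def]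
  refine integral_congr_ae ?_
  filter_upwards [mulOp_one_ae hf, mulOp_one_ae hg] with t h1 h2
  rw [h1, h2, RCLike.inner_apply, mul_comm]

lemma inner_one_mulOp_one [IsFiniteMeasure ν] {f : ℝ → ℂ} (hf : MemLp f ∞ ν) :
    ⟪one ν, mulOp ν f (one ν)⟫_ℂ = ∫ t, f t ∂ν := by
  have h := inner_mulOp_one (memLp_const (1 : ℂ)) hf
  rw [mulOp_const, one_smul, one_apply_eq_self] at h
  simpa using h

lemma inner_one_one [IsProbabilityMeasure ν] : ⟪one ν, one ν⟫_ℂ = 1 := by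
  have h := inner_one_mulOp_one (memLp_const (1 : ℂ)) (ν := ν)
  rw [mulOp_const, one_smul, one_apply_eq_self] at h
  simpa using h

lemma norm_one_eq [IsProbabilityMeasure ν] : ‖one ν‖ = 1 := by
  have h := inner_self_eq_norm_sq (𝕜 := ℂ) (one ν)
  rw [inner_one_one, RCLike.one_re] at h
  nlinarith [norm_nonneg (one ν)]

/-! ### Measures carried by a compact interval -/

variable {a b : ℝ}

lemma ae_mem_Icc (hν : ν (Set.Icc a b)ᶜ = 0) : ∀ᵐ t ∂ν, t ∈ Set.Icc a b := by
  rw [ae_iff]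
  exact hν

lemma memLp_id (hν : ν (Set.Icc a b)ᶜ = 0) : MemLp (fun t : ℝ => (t : ℂ)) ∞ ν := by
  refine memLp_top_of_bound (by fun_prop) (max |a| |b|) ?_
  filter_upwards [ae_mem_Icc hν] with t ht
  rw [Complex.norm_real]
  exact abs_le_max_abs_abs ht.1 ht.2

lemma support_subset_Icc (hν : ν (Set.Icc a b)ᶜ = 0) : ν.support ⊆ Set.Icc a b :=
  Measure.support_subset_of_isClosed isClosed_Icc (ae_mem_Icc hν)

lemma notMem_image_support (hν : ν (Set.Icc a b)ᶜ = 0) {ζ : ℂ} (hζ : ζ ∉ cSegment a b) :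
    ζ ∉ (fun t : ℝ => (t : ℂ)) '' ν.support :=
  fun h => hζ (Set.image_mono (support_subset_Icc hν) h)

/-- Off the support of `ν`, the resolvent function `t ↦ 1 / (ζ - t)` is essentially bounded. -/
lemma memLp_resolvent {ζ : ℂ} (hζ : ζ ∉ (fun t : ℝ => (t : ℂ)) '' ν.support) :
    MemLp (fun t : ℝ => 1 / (ζ - (t : ℂ))) ∞ ν := by
  have hcl : IsClosed ((fun t : ℝ => (t : ℂ)) '' ν.support) :=
    Complex.isometry_ofReal.isClosedEmbedding.isClosedMap _ Measure.isClosed_support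
  obtain ⟨ε, hε, hball⟩ := Metric.isOpen_iff.1 hcl.isOpen_compl ζ hζ
  have hm : Measurable fun t : ℝ => 1 / (ζ - (t : ℂ)) :=
    measurable_const.div (measurable_const.sub Complex.measurable_ofReal)
  refine memLp_top_of_bound hm.aestronglyMeasurable (1 / ε) ?_
  filter_upwards [Measure.support_mem_ae (μ := ν)] with t ht
  have h1 : ε ≤ ‖ζ - t‖ := by
    by_contra! hlt
    refine hball (a := (t : ℂ)) ?_ ⟨t, ht, rfl⟩
    rwa [Metric.mem_ball, dist_comm, dist_eq_norm]
  rw [norm_div, norm_one]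
  exact one_div_le_one_div_of_le hε h1

/-- The operator of multiplication by `1 / (ζ - t)`: the resolvent of `posOp ν`. -/
noncomputable abbrev resOp (ν : Measure ℝ) (ζ : ℂ) : Lp ℂ 2 ν →L[ℂ] Lp ℂ 2 ν :=
  mulOp ν fun t => 1 / (ζ - (t : ℂ))

lemma smul_one_sub_posOp [IsFiniteMeasure ν] (hν : ν (Set.Icc a b)ᶜ = 0) (ζ : ℂ) :
    ζ • 1 - posOp ν = mulOp ν (fun t => ζ - t) := by
  have h1 : MemLp (fun t : ℝ => ζ - (t : ℂ)) ∞ ν := (memLp_const ζ).sub (memLp_id hν)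
  rw [← mulOp_const, sub_eq_iff_eq_add, posOp, mulOp_add h1 (memLp_id hν)]
  simp

lemma mul_resOp [IsFiniteMeasure ν] (hν : ν (Set.Icc a b)ᶜ = 0) {ζ : ℂ}
    (hζ : ζ ∉ (fun t : ℝ => (t : ℂ)) '' ν.support) :
    (ζ • 1 - posOp ν) * resOp ν ζ = 1 := by
  have h1 : MemLp (fun t : ℝ => ζ - (t : ℂ)) ∞ ν := (memLp_const ζ).sub (memLp_id hν)
  rw [smul_one_sub_posOp hν, mulOp_mul h1 (memLp_resolvent hζ), ← one_smul ℂ (1 : _ →L[ℂ] _),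
    ← mulOp_const]
  refine mulOp_congr_ae ((memLp_resolvent hζ).mul' h1) ?_
  filter_upwards [Measure.support_mem_ae (μ := ν)] with t ht
  refine mul_one_div_cancel (sub_ne_zero.2 ?_)
  rintro rfl
  exact hζ ⟨t, ht, rfl⟩

lemma resOp_mul [IsFiniteMeasure ν] (hν : ν (Set.Icc a b)ᶜ = 0) {ζ : ℂ}
    (hζ : ζ ∉ (fun t : ℝ => (t : ℂ)) '' ν.support) :
    resOp ν ζ * (ζ • 1 - posOp ν) = 1 := by
  have h1 : MemLp (fun t : ℝ => ζ - (t : ℂ)) ∞ ν := (memLp_const ζ).sub (memLp_id hν)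
  have h := mul_resOp hν hζ
  rw [smul_one_sub_posOp hν, mulOp_mul h1 (memLp_resolvent hζ)] at h
  rw [smul_one_sub_posOp hν, mulOp_mul (memLp_resolvent hζ) h1, ← h]
  simp only [mul_comm]

lemma inner_one_resOp_one [IsFiniteMeasure ν] {ζ : ℂ}
    (hζ : ζ ∉ (fun t : ℝ => (t : ℂ)) '' ν.support) :
    ⟪one ν, resOp ν ζ (one ν)⟫_ℂ = markov ν ζ :=
  inner_one_mulOp_one (memLp_resolvent hζ)

lemma isSelfAdjoint_posOp (hν : ν (Set.Icc a b)ᶜ = 0) : IsSelfAdjoint (posOp ν) := by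
  rw [ContinuousLinearMap.isSelfAdjoint_iff_isSymmetric]
  intro x y
  simpa using inner_mulOp_left (memLp_id hν) x y

lemma inner_posOp_left (hν : ν (Set.Icc a b)ᶜ = 0) (x y : Lp ℂ 2 ν) :
    ⟪posOp ν x, y⟫_ℂ = ⟪x, posOp ν y⟫_ℂ := by
  simpa using inner_mulOp_left (memLp_id hν) x y

lemma inner_posOp_self (hν : ν (Set.Icc a b)ᶜ = 0) (x : Lp ℂ 2 ν) :
    a * ‖x‖ ^ 2 ≤ (⟪x, posOp ν x⟫_ℂ).re ∧ (⟪x, posOp ν x⟫_ℂ).re ≤ b * ‖x‖ ^ 2 := by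
  have hx : Integrable (fun t => ‖x t‖ ^ 2) ν := by
    simpa using (Lp.memLp x).integrable_norm_pow (by norm_num)
  have hint := L2.integrable_inner (𝕜 := ℂ) x (posOp ν x)
  have h1 : (⟪x, posOp ν x⟫_ℂ).re = ∫ t, t * ‖x t‖ ^ 2 ∂ν := by
    rw [L2.inner_def]
    have h0 := integral_re hint
    simp only [RCLike.re_to_complex] at h0
    rw [← h0]
    refine integral_congr_ae ?_
    filter_upwards [mulOp_apply_ae (memLp_id hν) x] with t ht
    rw [ht, RCLike.inner_apply, mul_assoc, Complex.mul_conj, Complex.normSq_eq_norm_sq,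
      ← Complex.ofReal_mul]
    exact Complex.ofReal_re _
  have h2 : ‖x‖ ^ 2 = ∫ t, ‖x t‖ ^ 2 ∂ν := by
    have h3 := integral_re (L2.integrable_inner (𝕜 := ℂ) x x)
    rw [← inner_self_eq_norm_sq (𝕜 := ℂ), L2.inner_def, ← h3]
    simp only [inner_self_eq_norm_sq]
  have hmid : Integrable (fun t => t * ‖x t‖ ^ 2) ν := by
    refine hx.bdd_mul (c := max |a| |b|) (by fun_prop) ?_
    filter_upwards [ae_mem_Icc hν] with t ht
    exact abs_le_max_abs_abs ht.1 ht.2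
  rw [h1, h2, ← integral_const_mul, ← integral_const_mul]
  constructor
  · refine integral_mono_ae (hx.const_mul a) hmid ?_
    filter_upwards [ae_mem_Icc hν] with t ht
    exact mul_le_mul_of_nonneg_right ht.1 (by positivity)
  · refine integral_mono_ae hmid (hx.const_mul b) ?_
    filter_upwards [ae_mem_Icc hν] with t ht
    exact mul_le_mul_of_nonneg_right ht.2 (by positivity)

/-! ### Polynomials in `L²(ν)` -/

lemma memLp_poly (hν : ν (Set.Icc a b)ᶜ = 0) [IsFiniteMeasure ν] (p : Polynomial ℂ) :
    MemLp (fun t : ℝ => p.eval (t : ℂ)) ∞ ν := by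
  obtain ⟨C, hC⟩ := isCompact_Icc.exists_bound_of_continuousOn (s := Set.Icc a b)
    (f := fun t : ℝ => p.eval (t : ℂ)) (by fun_prop)
  refine memLp_top_of_bound (by fun_prop) C ?_
  filter_upwards [ae_mem_Icc hν] with t ht using hC t ht

lemma aeval_posOp (hν : ν (Set.Icc a b)ᶜ = 0) [IsFiniteMeasure ν] (p : Polynomial ℂ) :
    Polynomial.aeval (posOp ν) p = mulOp ν (fun t => p.eval (t : ℂ)) := by
  induction p using Polynomial.induction_on' with
  | add p q hp hq =>
    rw [map_add, hp, hq, mulOp_add (memLp_poly hν p) (memLp_poly hν q)]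
    simp
  | monomial n c =>
    induction n with
    | zero => simp [mulOp_const, Algebra.algebraMap_eq_smul_one]
    | succ n ih =>
      rw [← Polynomial.monomial_mul_X, map_mul, ih, Polynomial.aeval_X,
        mulOp_mul (memLp_poly hν _) (memLp_id hν)]
      simp [pow_succ, mul_assoc]

lemma posOp_pow (hν : ν (Set.Icc a b)ᶜ = 0) [IsFiniteMeasure ν] (k : ℕ) :
    posOp ν ^ k = mulOp ν (fun t => (t : ℂ) ^ k) := by
  simpa using aeval_posOp hν (Polynomial.X ^ k)

lemma memLp_pow (hν : ν (Set.Icc a b)ᶜ = 0) [IsFiniteMeasure ν] (k : ℕ) :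
    MemLp (fun t : ℝ => (t : ℂ) ^ k) ∞ ν := by
  simpa using memLp_poly hν (Polynomial.X ^ k)

lemma inner_one_posOp_pow_one (hν : ν (Set.Icc a b)ᶜ = 0) [IsFiniteMeasure ν] (k : ℕ) :
    ⟪one ν, (posOp ν ^ k) (one ν)⟫_ℂ = ∫ t, (t : ℂ) ^ k ∂ν := by
  rw [posOp_pow hν, inner_one_mulOp_one (memLp_pow hν k)]

/-- The constant function `1` is a cyclic vector for multiplication by `t`: this is the
Weierstrass approximation theorem. -/
lemma eq_top_of_invariant (hν : ν (Set.Icc a b)ᶜ = 0) [IsProbabilityMeasure ν]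
    (M : Submodule ℂ (Lp ℂ 2 ν)) (hM : IsClosed (M : Set (Lp ℂ 2 ν))) (h1 : one ν ∈ M)
    (hT : ∀ x ∈ M, posOp ν x ∈ M) : M = ⊤ := by
  have hpoly : ∀ p : Polynomial ℂ, Polynomial.aeval (posOp ν) p (one ν) ∈ M := by
    intro p
    induction p using Polynomial.induction_on' with
    | add p q hp hq => simpa using M.add_mem hp hq
    | monomial n c =>
      induction n with
      | zero => simpa [Algebra.algebraMap_eq_smul_one] using M.smul_mem c h1
      | succ n ih =>
        rw [← Polynomial.X_mul_monomial, map_mul, Polynomial.aeval_X,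
          mul_apply_eq_comp]
        exact hT _ ih
  have hbcf : Set.range (BoundedContinuousFunction.toLp 2 ν ℂ : _ →L[ℂ] Lp ℂ 2 ν) ⊆ M := by
    rintro _ ⟨f, rfl⟩
    rw [← hM.closure_eq, Metric.mem_closure_iff]
    intro ε hε
    obtain ⟨p, hp⟩ := exists_polynomial_near_of_continuousOn a b (fun t => (f t).re)
      (by fun_prop) (ε / 4) (by positivity)
    obtain ⟨q, hq⟩ := exists_polynomial_near_of_continuousOn a b (fun t => (f t).im)
      (by fun_prop) (ε / 4) (by positivity)
    set P : Polynomial ℂ :=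
      p.map Complex.ofRealHom + Polynomial.C Complex.I * q.map Complex.ofRealHom with hP
    refine ⟨_, hpoly P, ?_⟩
    rw [dist_eq_norm]
    refine lt_of_le_of_lt (Lp.norm_le_of_ae_bound (C := ε / 2) (by positivity) ?_) ?_
    · rw [aeval_posOp hν]
      filter_upwards [mulOp_one_ae (memLp_poly hν P), ae_mem_Icc hν,
        Lp.coeFn_sub (BoundedContinuousFunction.toLp 2 ν ℂ f)
          (mulOp ν (fun t => P.eval (t : ℂ)) (one ν)),
        BoundedContinuousFunction.coeFn_toLp (p := 2) ν ℂ f] with t h1 h2 h3 h4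
      rw [h3, Pi.sub_apply, h1, h4]
      have hev : P.eval (t : ℂ) = (p.eval t : ℝ) + Complex.I * (q.eval t : ℝ) := by
        have hmap : ∀ r : Polynomial ℝ,
            (r.map Complex.ofRealHom).eval (t : ℂ) = (r.eval t : ℝ) := fun r =>
          Polynomial.eval_map_apply Complex.ofRealHom t
        rw [hP, Polynomial.eval_add, Polynomial.eval_mul, Polynomial.eval_C, hmap, hmap]
      refine (Complex.norm_le_abs_re_add_abs_im _).trans ?_
      have hre := hp t h2
      have him := hq t h2
      rw [abs_sub_comm] at hre him
      simp only [hev, Complex.sub_re, Complex.add_re, Complex.ofReal_re, Complex.mul_re,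
        Complex.I_re, Complex.I_im, Complex.ofReal_im, Complex.sub_im, Complex.add_im,
        Complex.mul_im, zero_mul, one_mul, mul_zero, sub_zero, add_zero, zero_add]
      linarith
    · simp [measureUnivNNReal]
      linarith
  refine Submodule.eq_top_iff'.2 fun x => ?_
  exact hM.closure_subset_iff.2 hbcf
    (BoundedContinuousFunction.toLp_denseRange ℂ ν ℂ (by norm_num) x)

end

/-! ### Spectral measures of bounded self-adjoint operators -/

section SpectralMeasure

variable {K : Type*} [NormedAddCommGroup K] [InnerProductSpace ℂ K] [CompleteSpace K]

/-- A self-adjoint operator whose quadratic form lies between `a` and `b` has its spectrum in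
`[a, b]`. -/
lemma spectrum_subset_Icc {S : K →L[ℂ] K} (hS : IsSelfAdjoint S) {a b : ℝ}
    (hab : ∀ x, a * ‖x‖ ^ 2 ≤ (⟪x, S x⟫_ℂ).re ∧ (⟪x, S x⟫_ℂ).re ≤ b * ‖x‖ ^ 2) :
    spectrum ℝ S ⊆ Set.Icc a b := by
  have hsm : ∀ (c : ℝ) (x : K), (⟪x, algebraMap ℝ (K →L[ℂ] K) c x⟫_ℂ).re = c * ‖x‖ ^ 2 := by
    intro c x
    rw [Algebra.algebraMap_eq_smul_one]
    have h : (c • (1 : K →L[ℂ] K)) x = (c : ℂ) • x := by simp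
    rw [h, inner_smul_right, Complex.re_ofReal_mul]
    congr 1
    exact inner_self_eq_norm_sq (𝕜 := ℂ) x
  have hsa : ∀ c : ℝ, IsSelfAdjoint (algebraMap ℝ (K →L[ℂ] K) c) := fun c =>
    IsSelfAdjoint.algebraMap _ (.all c)
  intro t ht
  constructor
  · refine (algebraMap_le_iff_le_spectrum (a := S)).1 ?_ t ht
    rw [ContinuousLinearMap.le_def, ContinuousLinearMap.isPositive_def]
    refine ⟨ContinuousLinearMap.isSelfAdjoint_iff_isSymmetric.1 (hS.sub (hsa a)), fun x => ?_⟩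
    rw [ContinuousLinearMap.reApplyInnerSelf_apply, inner_re_symm,
      _root_.sub_apply, inner_sub_right, map_sub]
    exact sub_nonneg.2 ((hsm a x).le.trans (hab x).1)
  · refine (le_algebraMap_iff_spectrum_le (a := S)).1 ?_ t ht
    rw [ContinuousLinearMap.le_def, ContinuousLinearMap.isPositive_def]
    refine ⟨ContinuousLinearMap.isSelfAdjoint_iff_isSymmetric.1 ((hsa b).sub hS), fun x => ?_⟩
    rw [ContinuousLinearMap.reApplyInnerSelf_apply, inner_re_symm,
      _root_.sub_apply, inner_sub_right, map_sub]
    exact sub_nonneg.2 ((hab x).2.trans (hsm b x).ge)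

/-- The spectral measure of a bounded self-adjoint operator at a unit vector, obtained from the
continuous functional calculus and the Riesz–Markov–Kakutani theorem on the spectrum. -/
lemma exists_spectralMeasure {S : K →L[ℂ] K} (hS : IsSelfAdjoint S) {a b : ℝ}
    (hab : ∀ x, a * ‖x‖ ^ 2 ≤ (⟪x, S x⟫_ℂ).re ∧ (⟪x, S x⟫_ℂ).re ≤ b * ‖x‖ ^ 2)
    {q : K} (hq : ‖q‖ = 1) :
    ∃ ν : Measure ℝ, IsProbabilityMeasure ν ∧ ν (Set.Icc a b)ᶜ = 0 ∧
      ∀ k : ℕ, ⟪q, (S ^ k) q⟫_ℂ = ∫ t, (t : ℂ) ^ k ∂ν := by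
  let F : C(spectrum ℝ S, ℝ) →⋆ₐ[ℝ] (K →L[ℂ] K) := cfcHom hS
  have hFsa : ∀ f, IsSelfAdjoint (F f) := fun f => cfcHom_predicate hS f
  let Λ₀ : CompactlySupportedContinuousMap (spectrum ℝ S) ℝ →ₗ[ℝ] ℝ :=
    { toFun := fun f => (⟪q, F f.toContinuousMap q⟫_ℂ).re
      map_add' := fun f g => by
        have h : (f + g).toContinuousMap = f.toContinuousMap + g.toContinuousMap := rfl
        simp [h]
      map_smul' := fun c f => by
        have h : (c • f).toContinuousMap = c • f.toContinuousMap := rfl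
        have h2 : (c • F f.toContinuousMap) q = (c : ℂ) • F f.toContinuousMap q := by simp
        rw [h, map_smul, h2, inner_smul_right, Complex.re_ofReal_mul]
        simp }
  have hpos : ∀ f, 0 ≤ f → 0 ≤ Λ₀ f := by
    intro f hf
    -- A nonnegative `f` is a square `g * g`, so that `⟨q, f(S) q⟩ = ‖g(S) q‖²`.
    let g : C(spectrum ℝ S, ℝ) := ⟨fun t => Real.sqrt (f t), by fun_prop⟩
    have hfg : f.toContinuousMap = g * g := by
      ext t
      exact (Real.mul_self_sqrt (hf t)).symm
    have hsym := ContinuousLinearMap.isSelfAdjoint_iff_isSymmetric.1 (hFsa g)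
    change 0 ≤ (⟪q, F f.toContinuousMap q⟫_ℂ).re
    rw [hfg, map_mul, mul_apply_eq_comp]
    have h := hsym q (F g q)
    simp only [ContinuousLinearMap.coe_coe] at h
    rw [← h]
    exact inner_self_nonneg (𝕜 := ℂ)
  let Λ := PositiveLinearMap.mk₀ Λ₀ hpos
  let ρ := RealRMK.rieszMeasure Λ
  have hint : ∀ f : C(spectrum ℝ S, ℝ), ∫ t, f t ∂ρ = (⟪q, F f q⟫_ℂ).re := fun f =>
    RealRMK.integral_rieszMeasure Λ ⟨f, .of_compactSpace f⟩
  have hρ : IsProbabilityMeasure ρ := by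
    have h := hint 1
    rw [map_one, one_apply_eq_self, ← RCLike.re_eq_complex_re, inner_self_eq_norm_sq, hq] at h
    simp only [ContinuousMap.one_apply, integral_const, smul_eq_mul, mul_one, one_pow] at h
    exact ⟨(ENNReal.toReal_eq_one_iff _).1 h⟩
  have hmeas : Measurable (Subtype.val : spectrum ℝ S → ℝ) := measurable_subtype_coe
  refine ⟨ρ.map Subtype.val, Measure.isProbabilityMeasure_map hmeas.aemeasurable, ?_, ?_⟩
  · rw [Measure.map_apply hmeas measurableSet_Icc.compl]
    convert measure_empty (μ := ρ)
    ext t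
    simpa using! spectrum_subset_Icc hS hab t.2
  · intro k
    have hk : F (ContinuousMap.restrict (spectrum ℝ S) (.id ℝ) ^ k) = S ^ k := by
      rw [map_pow]
      congr 1
      exact cfcHom_id hS
    have him : (⟪q, (S ^ k) q⟫_ℂ).im = 0 :=
      (ContinuousLinearMap.isSelfAdjoint_iff_isSymmetric.1 (hS.pow k)).im_inner_self_apply q
    have h := hint (ContinuousMap.restrict (spectrum ℝ S) (.id ℝ) ^ k)
    rw [hk] at h
    rw [integral_map hmeas.aemeasurable (by fun_prop)]
    have h3 : ∫ t : spectrum ℝ S, ((t : ℝ) : ℂ) ^ k ∂ρ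
        = ((∫ t : spectrum ℝ S, (t : ℝ) ^ k ∂ρ : ℝ) : ℂ) := by
      rw [← integral_complex_ofReal]
      simp
    rw [h3]
    refine Complex.ext ?_ ?_
    · rw [← h, Complex.ofReal_re]
      rfl
    · rw [him, Complex.ofReal_im]

lemma inner_pow_pow {S : K →L[ℂ] K} (hS : IsSelfAdjoint S) (m n : ℕ) (v : K) :
    ⟪(S ^ m) v, (S ^ n) v⟫_ℂ = ⟪v, (S ^ (m + n)) v⟫_ℂ := by
  have h := ContinuousLinearMap.isSelfAdjoint_iff_isSymmetric.1 (hS.pow m) v ((S ^ n) v)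
  simp only [ContinuousLinearMap.coe_coe] at h
  rw [h, pow_add, mul_apply_eq_comp]

/-- If the moments of a self-adjoint operator `S` at `q` are the moments of `ν`, then `L²(ν)` with
multiplication by `t` is a model for the cyclic subspace of `S` generated by `q`. -/
lemma exists_linearIsometry_of_moments {S : K →L[ℂ] K} (hS : IsSelfAdjoint S) {q : K}
    {ν : Measure ℝ} [IsProbabilityMeasure ν] {a b : ℝ} (hν : ν (Set.Icc a b)ᶜ = 0)
    (hmom : ∀ k : ℕ, ⟪q, (S ^ k) q⟫_ℂ = ∫ t, (t : ℂ) ^ k ∂ν) :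
    ∃ J : Lp ℂ 2 ν →ₗᵢ[ℂ] K, J (one ν) = q ∧ ∀ f, J (posOp ν f) = S (J f) := by
  -- Both maps are defined on polynomials by functional calculus; `e` has dense range and the
  -- moments show that `e p ↦ g p` preserves inner products.
  let e : Polynomial ℂ →ₗ[ℂ] Lp ℂ 2 ν :=
    (ContinuousLinearMap.apply ℂ _ (one ν)).toLinearMap ∘ₗ
      (Polynomial.aeval (posOp ν)).toLinearMap
  let g : Polynomial ℂ →ₗ[ℂ] K :=
    (ContinuousLinearMap.apply ℂ _ q).toLinearMap ∘ₗ (Polynomial.aeval S).toLinearMap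
  have he : ∀ p, e p = Polynomial.aeval (posOp ν) p (one ν) := fun p => rfl
  have hg : ∀ p, g p = Polynomial.aeval S p q := fun p => rfl
  have hinner : ∀ p r, ⟪g p, g r⟫_ℂ = ⟪e p, e r⟫_ℂ := by
    intro p r
    induction p using Polynomial.induction_on' with
    | add p p' hp hp' => simp only [map_add, inner_add_left, hp, hp']
    | monomial m c =>
      induction r using Polynomial.induction_on' with
      | add r r' hr hr' => simp only [map_add, inner_add_right, hr, hr']
      | monomial n d =>
        simp only [hg, he, Polynomial.aeval_monomial, ← Algebra.smul_def]
        simp only [_root_.smul_apply, inner_smul_left, inner_smul_right]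
        rw [inner_pow_pow hS, inner_pow_pow (isSelfAdjoint_posOp hν), hmom,
          inner_one_posOp_pow_one hν]
  have hnorm : ∀ p, ‖g p‖ = ‖e p‖ := fun p => by
    rw [norm_eq_sqrt_re_inner (𝕜 := ℂ), norm_eq_sqrt_re_inner (𝕜 := ℂ), hinner]
  have heX : ∀ p, e (Polynomial.X * p) = posOp ν (e p) := fun p => by
    rw [he, he, map_mul, Polynomial.aeval_X, mul_apply_eq_comp]
  have hgX : ∀ p, g (Polynomial.X * p) = S (g p) := fun p => by
    rw [hg, hg, map_mul, Polynomial.aeval_X, mul_apply_eq_comp]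
  have hdense : DenseRange e := by
    have htop := eq_top_of_invariant hν (LinearMap.range e).topologicalClosure
      (Submodule.isClosed_topologicalClosure _)
      (Submodule.le_topologicalClosure _ ⟨1, by simp [he]⟩) ?_
    · rw [DenseRange, dense_iff_closure_eq]
      have h := congrArg (fun M : Submodule ℂ (Lp ℂ 2 ν) => (M : Set (Lp ℂ 2 ν))) htop
      simpa [LinearMap.coe_range] using h
    · intro x hx
      refine map_mem_closure (posOp ν).continuous hx ?_
      rintro _ ⟨p, rfl⟩
      exact ⟨Polynomial.X * p, heX p⟩
  have hbound : ∃ C, ∀ p, ‖g p‖ ≤ C * ‖e p‖ := ⟨1, fun p => by rw [hnorm, one_mul]⟩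
  let J₀ := g.extendOfNorm e
  have hJ₀ : ∀ p, J₀ (e p) = g p := LinearMap.extendOfNorm_eq hdense hbound
  refine ⟨⟨J₀.toLinearMap, fun x => ?_⟩, ?_, fun f => ?_⟩
  · refine hdense.induction_on (p := fun x => ‖J₀ x‖ = ‖x‖) x
      (isClosed_eq (by fun_prop) (by fun_prop)) fun p => ?_
    rw [hJ₀, hnorm]
  · have h := hJ₀ 1
    simpa [he, hg] using h
  · refine hdense.induction_on (p := fun f => J₀ (posOp ν f) = S (J₀ f)) f
      (isClosed_eq (by fun_prop) (by fun_prop)) fun p => ?_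
    rw [← heX, hJ₀, hJ₀, hgX]

end SpectralMeasure

section

variable {ν : Measure ℝ} {a b : ℝ}

/-! ### The normalized resolvent vector -/

lemma resOp_one_spec [IsFiniteMeasure ν] (hν : ν (Set.Icc a b)ᶜ = 0) {ζ : ℂ}
    (hζ : ζ ∉ cSegment a b) :
    posOp ν (resOp ν ζ (one ν)) = ζ • resOp ν ζ (one ν) - one ν := by
  have h := congrArg (fun P : Lp ℂ 2 ν →L[ℂ] Lp ℂ 2 ν => P (one ν))
    (mul_resOp hν (notMem_image_support hν hζ))
  simp only [mul_apply_eq_comp, one_apply_eq_self, _root_.sub_apply, _root_.smul_apply] at h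
  nth_rewrite 3 [← h]
  abel

/-- The Markov function does not vanish off `[a, b]`: at a zero `ζ` the vector `(ζ - t)⁻¹` would
have Rayleigh quotient `ζ`, which would have to lie in `[a, b]`. -/
lemma markov_ne_zero [IsProbabilityMeasure ν] (hν : ν (Set.Icc a b)ᶜ = 0) {ζ : ℂ}
    (hζ : ζ ∉ cSegment a b) : markov ν ζ ≠ 0 := by
  intro h0
  set x := resOp ν ζ (one ν) with hx
  have hTx : posOp ν x = ζ • x - one ν := resOp_one_spec hν hζ
  have hx0 : x ≠ 0 := by
    intro h
    rw [h, map_zero, smul_zero, zero_sub, zero_eq_neg] at hTx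
    have := norm_one_eq (ν := ν)
    rw [hTx, norm_zero] at this
    exact zero_ne_one this
  have hxpos : 0 < ‖x‖ ^ 2 := by positivity
  have h1 : ⟪x, posOp ν x⟫_ℂ = ζ * ((‖x‖ ^ 2 : ℝ) : ℂ) := by
    have h2 : ⟪x, one ν⟫_ℂ = 0 := by
      rw [← inner_conj_symm, hx, inner_one_resOp_one (notMem_image_support hν hζ), h0, map_zero]
    have h3 := inner_self_eq_norm_sq_to_K (𝕜 := ℂ) x
    rw [hTx, inner_sub_right, inner_smul_right, h2, sub_zero, h3]
    simp
  have him : (⟪x, posOp ν x⟫_ℂ).im = 0 :=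
    (ContinuousLinearMap.isSelfAdjoint_iff_isSymmetric.1
      (isSelfAdjoint_posOp hν)).im_inner_self_apply x
  have hbd := inner_posOp_self hν x
  rw [h1] at him hbd
  rw [Complex.im_mul_ofReal] at him
  rw [Complex.re_mul_ofReal] at hbd
  have hζim : ζ.im = 0 := by
    rcases mul_eq_zero.1 him with h | h
    · exact h
    · exact absurd h hxpos.ne'
  refine hζ ⟨ζ.re, ⟨le_of_mul_le_mul_right hbd.1 hxpos, le_of_mul_le_mul_right hbd.2 hxpos⟩, ?_⟩
  exact Complex.ext (by simp) (by simp [hζim])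

/-- The function `t ↦ (w - t)⁻¹ / φ(w)` in `L²(ν)`, where `φ` is the Markov function of `ν`. -/
noncomputable def resVec (ν : Measure ℝ) [IsFiniteMeasure ν] (w : ℂ) : Lp ℂ 2 ν :=
  (markov ν w)⁻¹ • resOp ν w (one ν)

lemma posOp_resVec [IsFiniteMeasure ν] (hν : ν (Set.Icc a b)ᶜ = 0) {w : ℂ}
    (hw : w ∉ cSegment a b) :
    posOp ν (resVec ν w) = w • resVec ν w - (markov ν w)⁻¹ • one ν := by
  rw [resVec, map_smul, resOp_one_spec hν hw, smul_sub, smul_comm]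

lemma inner_one_resVec [IsProbabilityMeasure ν] (hν : ν (Set.Icc a b)ᶜ = 0) {w : ℂ}
    (hw : w ∉ cSegment a b) : ⟪one ν, resVec ν w⟫_ℂ = 1 := by
  rw [resVec, inner_smul_right, inner_one_resOp_one (notMem_image_support hν hw),
    inv_mul_cancel₀ (markov_ne_zero hν hw)]

lemma conj_inv_mul_inv (c : ℂ) : conj c⁻¹ * c⁻¹ = (((‖c‖ ^ 2)⁻¹ : ℝ) : ℂ) := by
  rw [mul_comm, Complex.mul_conj, Complex.normSq_eq_norm_sq, norm_inv, inv_pow]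

lemma inner_resVec_self [IsProbabilityMeasure ν] (hν : ν (Set.Icc a b)ᶜ = 0) {w : ℂ}
    (hw : w ∉ cSegment a b) : ⟪resVec ν w, resVec ν w⟫_ℂ = (diagB ν w : ℂ) := by
  have hR := memLp_resolvent (notMem_image_support hν hw)
  rw [resVec, inner_smul_left, inner_smul_right, inner_mulOp_one hR hR, ← mul_assoc,
    conj_inv_mul_inv]
  have h : ∫ t, conj (1 / (w - (t : ℂ))) * (1 / (w - (t : ℂ))) ∂ν
      = ((∫ t, 1 / ‖w - (t : ℂ)‖ ^ 2 ∂ν : ℝ) : ℂ) := by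
    rw [← integral_complex_ofReal]
    refine integral_congr_ae (Eventually.of_forall fun t => ?_)
    simp only [one_div]
    exact conj_inv_mul_inv _
  rw [h, diagB, ← Complex.ofReal_mul]
  congr 1
  ring

lemma inner_resVec_posOp [IsProbabilityMeasure ν] (hν : ν (Set.Icc a b)ᶜ = 0) {w : ℂ}
    (hw : w ∉ cSegment a b) :
    ⟪resVec ν w, posOp ν (resVec ν w)⟫_ℂ = (diagA ν w : ℂ) := by
  have hR := memLp_resolvent (notMem_image_support hν hw)
  have hT : posOp ν (resOp ν w (one ν)) = mulOp ν (fun t => t * (1 / (w - (t : ℂ)))) (one ν) := by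
    rw [← mulOp_mul (memLp_id hν) hR, mul_apply_eq_comp]
  rw [resVec, map_smul, hT, inner_smul_left, inner_smul_right,
    inner_mulOp_one hR (hR.mul' (memLp_id hν)), ← mul_assoc, conj_inv_mul_inv]
  have h : ∫ t, conj (1 / (w - (t : ℂ))) * (t * (1 / (w - (t : ℂ)))) ∂ν
      = ((∫ t, t / ‖w - (t : ℂ)‖ ^ 2 ∂ν : ℝ) : ℂ) := by
    rw [← integral_complex_ofReal]
    refine integral_congr_ae (Eventually.of_forall fun t => ?_)
    simp only [one_div]
    rw [mul_left_comm, conj_inv_mul_inv]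
    push_cast
    rw [div_eq_mul_inv]
  rw [h, diagA, ← Complex.ofReal_mul]
  congr 1
  ring

lemma norm_resVec_sub_one [IsProbabilityMeasure ν] (hν : ν (Set.Icc a b)ᶜ = 0) {w : ℂ}
    (hw : w ∉ cSegment a b) : ‖resVec ν w - one ν‖ ^ 2 = diagB ν w - 1 := by
  have h1 := inner_one_resVec hν hw
  have h2 : ⟪resVec ν w, one ν⟫_ℂ = 1 := by rw [← inner_conj_symm, h1, map_one]
  have h : ((‖resVec ν w - one ν‖ ^ 2 : ℝ) : ℂ) = ((diagB ν w - 1 : ℝ) : ℂ) := by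
    have h3 := inner_self_eq_norm_sq_to_K (𝕜 := ℂ) (resVec ν w - one ν)
    rw [inner_sub_left, inner_sub_right, inner_sub_right, inner_resVec_self hν hw, h1, h2,
      inner_one_one] at h3
    push_cast
    simpa using h3.symm
  exact_mod_cast h

lemma offB_eq_norm [IsProbabilityMeasure ν] (hν : ν (Set.Icc a b)ᶜ = 0) {w : ℂ}
    (hw : w ∉ cSegment a b) : offB ν w = ‖resVec ν w - one ν‖ := by
  rw [offB, ← norm_resVec_sub_one hν hw, Real.sqrt_sq (norm_nonneg _)]

lemma one_add_offB_sq [IsProbabilityMeasure ν] (hν : ν (Set.Icc a b)ᶜ = 0) {w : ℂ}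
    (hw : w ∉ cSegment a b) : 1 + offB ν w ^ 2 = diagB ν w := by
  rw [offB_eq_norm hν hw, norm_resVec_sub_one hν hw]
  ring

/-! ### One step of the continued fraction -/

/-- A finite-dimensional subspace that contains `1` and is invariant under multiplication by `t`
is all of `L²(ν)`. -/
lemma finiteDimensional_of_invariant [IsProbabilityMeasure ν] (hν : ν (Set.Icc a b)ᶜ = 0)
    (F : Submodule ℂ (Lp ℂ 2 ν)) [FiniteDimensional ℂ F] (h1 : one ν ∈ F)
    (hT : ∀ x ∈ F, posOp ν x ∈ F) : FiniteDimensional ℂ (Lp ℂ 2 ν) := by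
  have h := eq_top_of_invariant hν F F.closed_of_finiteDimensional h1 hT
  subst h
  exact Module.Finite.equiv (Submodule.topEquiv : (⊤ : Submodule ℂ (Lp ℂ 2 ν)) ≃ₗ[ℂ] _)

/-- If `offB` vanished, `(w - t)⁻¹` would be constant in `L²(ν)`, so that the constants would be
invariant under multiplication by `t`. -/
lemma offB_ne_zero [IsProbabilityMeasure ν] (hν : ν (Set.Icc a b)ᶜ = 0) {w : ℂ}
    (hw : w ∉ cSegment a b) (hinf : ¬ FiniteDimensional ℂ (Lp ℂ 2 ν)) : offB ν w ≠ 0 := by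
  intro h
  rw [offB_eq_norm hν hw, norm_eq_zero, sub_eq_zero] at h
  have hT := posOp_resVec hν hw
  rw [h, ← sub_smul] at hT
  refine hinf (finiteDimensional_of_invariant hν (ℂ ∙ one ν) (Submodule.mem_span_singleton_self _)
    fun x hx => ?_)
  obtain ⟨c, rfl⟩ := Submodule.mem_span_singleton.1 hx
  rw [map_smul, hT]
  exact Submodule.smul_mem _ _ (Submodule.smul_mem _ _ (Submodule.mem_span_singleton_self _))

/-- The isometry `J` realizes `L²(ν')` inside the orthogonal complement of `1` in `L²(ν)`, in such
a way that multiplication by `t` on `L²(ν')` is the compression of multiplication by `t` on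
`L²(ν)`, and `1` is mapped to the normalized component of `(w - t)⁻¹` orthogonal to `1`. -/
structure IsStep (ν ν' : Measure ℝ) [IsFiniteMeasure ν] [IsFiniteMeasure ν'] (w : ℂ)
    (J : Lp ℂ 2 ν' →ₗᵢ[ℂ] Lp ℂ 2 ν) : Prop where
  orthogonal : ∀ f, ⟪one ν, J f⟫_ℂ = 0
  compression : ∀ f, ∃ c : ℂ, posOp ν (J f) = J (posOp ν' f) + c • one ν
  one_add : one ν + (offB ν w : ℂ) • J (one ν') = resVec ν w

/-- Every measure with infinite-dimensional `L²` has a successor: the spectral measure of the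
compression of multiplication by `t` to the orthogonal complement of `1`. -/
lemma exists_isStep [IsProbabilityMeasure ν] (hν : ν (Set.Icc a b)ᶜ = 0) {w : ℂ}
    (hw : w ∉ cSegment a b) (hinf : ¬ FiniteDimensional ℂ (Lp ℂ 2 ν)) :
    ∃ (ν' : Measure ℝ) (_ : IsProbabilityMeasure ν'), ν' (Set.Icc a b)ᶜ = 0 ∧
      ∃ J : Lp ℂ 2 ν' →ₗᵢ[ℂ] Lp ℂ 2 ν, IsStep ν ν' w J := by
  let K : Submodule ℂ (Lp ℂ 2 ν) := (ℂ ∙ one ν)ᗮ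
  have hK : ∀ x, x ∈ K ↔ ⟪one ν, x⟫_ℂ = 0 := fun x =>
    Submodule.mem_orthogonal_singleton_iff_inner_right
  let S : K →L[ℂ] K := K.orthogonalProjectionOnto ∘L posOp ν ∘L K.subtypeL
  have hSinner : ∀ x y : K, ⟪x, S y⟫_ℂ = ⟪(x : Lp ℂ 2 ν), posOp ν y⟫_ℂ := fun x y =>
    Submodule.inner_orthogonalProjectionOnto_eq_of_mem_left x _
  have hS : IsSelfAdjoint S := by
    rw [ContinuousLinearMap.isSelfAdjoint_iff_isSymmetric]
    intro x y
    simp only [ContinuousLinearMap.coe_coe]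
    rw [hSinner, ← inner_conj_symm, hSinner, inner_conj_symm, inner_posOp_left hν]
  have hSdef : ∀ y : K, ∃ c : ℂ, posOp ν (y : Lp ℂ 2 ν) = S y + c • one ν := by
    intro y
    have h := Submodule.sub_starProjection_mem_orthogonal (K := K) (posOp ν y)
    rw [Submodule.orthogonal_orthogonal, Submodule.mem_span_singleton] at h
    obtain ⟨c, hc⟩ := h
    exact ⟨c, by rw [hc]; exact (add_sub_cancel _ _).symm⟩
  have hoff := offB_ne_zero hν hw hinf
  have hmem : resVec ν w - one ν ∈ K := by
    rw [hK, inner_sub_right, inner_one_resVec hν hw, inner_one_one, sub_self]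
  let q : K := ((offB ν w : ℂ)⁻¹) • ⟨_, hmem⟩
  have hq : ‖q‖ = 1 := by
    have h : ‖q‖ = ‖(offB ν w : ℂ)⁻¹‖ * ‖resVec ν w - one ν‖ := norm_smul _ _
    rw [h, ← offB_eq_norm hν hw, norm_inv, Complex.norm_real, Real.norm_of_nonneg (r := offB ν w)
      (Real.sqrt_nonneg _), inv_mul_cancel₀ hoff]
  obtain ⟨ν', hprob, hν', hmom⟩ := exists_spectralMeasure hS (a := a) (b := b) (fun x => by
    rw [hSinner]; exact inner_posOp_self hν x) hq
  obtain ⟨J, hJ1, hJT⟩ := exists_linearIsometry_of_moments hS hν' hmom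
  refine ⟨ν', hprob, hν', K.subtypeₗᵢ.comp J, fun f => (hK _).1 (J f).2, fun f => ?_, ?_⟩
  · obtain ⟨c, hc⟩ := hSdef (J f)
    refine ⟨c, ?_⟩
    change posOp ν (J f : Lp ℂ 2 ν) = (J (posOp ν' f) : Lp ℂ 2 ν) + c • one ν
    rw [hJT, hc]
  · change one ν + (offB ν w : ℂ) • (J (one ν') : Lp ℂ 2 ν) = _
    rw [hJ1]
    have h : (q : Lp ℂ 2 ν) = ((offB ν w : ℂ)⁻¹) • (resVec ν w - one ν) := rfl
    rw [h, smul_smul, mul_inv_cancel₀ (by exact_mod_cast hoff), one_smul]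
    abel

namespace IsStep

variable {ν' : Measure ℝ} [IsProbabilityMeasure ν] [IsProbabilityMeasure ν'] {w : ℂ}
  {J : Lp ℂ 2 ν' →ₗᵢ[ℂ] Lp ℂ 2 ν}

/-- If `L²(ν')` were finite-dimensional, its image together with `1` would span a
finite-dimensional subspace invariant under multiplication by `t`. -/
lemma infiniteDimensional (h : IsStep ν ν' w J) (hν : ν (Set.Icc a b)ᶜ = 0)
    (hw : w ∉ cSegment a b) (hinf : ¬ FiniteDimensional ℂ (Lp ℂ 2 ν)) :
    ¬ FiniteDimensional ℂ (Lp ℂ 2 ν') := by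
  intro hfin
  let F : Submodule ℂ (Lp ℂ 2 ν) := (ℂ ∙ one ν) ⊔ LinearMap.range J.toLinearMap
  have h1 : one ν ∈ F := Submodule.mem_sup_left (Submodule.mem_span_singleton_self _)
  have hJ : ∀ f, J f ∈ F := fun f => Submodule.mem_sup_right ⟨f, rfl⟩
  have hTJ : ∀ f, posOp ν (J f) ∈ F := fun f => by
    obtain ⟨c, hc⟩ := h.compression f
    rw [hc]
    exact F.add_mem (hJ _) (F.smul_mem _ h1)
  have hT1 : posOp ν (one ν) ∈ F := by
    have h2 : one ν = resVec ν w - (offB ν w : ℂ) • J (one ν') := by rw [← h.one_add]; abel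
    rw [h2, map_sub, map_smul, posOp_resVec hν hw, ← h.one_add]
    exact F.sub_mem (F.sub_mem (F.smul_mem _ (F.add_mem h1 (F.smul_mem _ (hJ _))))
      (F.smul_mem _ h1)) (F.smul_mem _ (hTJ _))
  have : FiniteDimensional ℂ (LinearMap.range J.toLinearMap) := inferInstance
  have : FiniteDimensional ℂ F := Submodule.finiteDimensional_sup _ _
  refine hinf (finiteDimensional_of_invariant hν F h1 fun x hx => ?_)
  obtain ⟨y, hy, z, ⟨f, rfl⟩, rfl⟩ := Submodule.mem_sup.1 hx
  obtain ⟨c, rfl⟩ := Submodule.mem_span_singleton.1 hy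
  rw [map_add, map_smul]
  exact F.add_mem (F.smul_mem _ hT1) (hTJ f)

/-- The continued fraction recurrence for the Markov functions. With `y = (ζ - t)⁻¹` in `L²(ν')`,
the vector `r + b (w - ζ) J y` is a multiple of `(ζ - t)⁻¹`, and pairing `ζ - t` applied to it with
`1` and with `r` gives the two sides. -/
lemma recurrence (h : IsStep ν ν' w J) (hν : ν (Set.Icc a b)ᶜ = 0) (hν' : ν' (Set.Icc a b)ᶜ = 0)
    (hw : w ∉ cSegment a b) {ζ : ℂ} (hζ : ζ ∉ cSegment a b) :
    markov ν ζ = 1 / (ζ * (diagB ν w : ℂ) - (diagA ν w : ℂ)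
      - (offB ν w : ℂ) ^ 2 * (ζ - w) * (ζ - conj w) * markov ν' ζ) := by
  set r := resVec ν w with hr
  set β : ℂ := (offB ν w : ℂ) with hβ
  set y := resOp ν' ζ (one ν') with hy
  have hTy : posOp ν' y = ζ • y - one ν' := resOp_one_spec hν' hζ
  have hTr : posOp ν r = w • r - (markov ν w)⁻¹ • one ν := posOp_resVec hν hw
  have hr1 : ⟪r, one ν⟫_ℂ = 1 := by
    rw [← inner_conj_symm, hr, inner_one_resVec hν hw, map_one]
  have hrJ : ⟪r, J y⟫_ℂ = β * markov ν' ζ := by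
    rw [hr, ← h.one_add, inner_add_left, h.orthogonal, inner_smul_left, J.inner_map_map,
      inner_one_resOp_one (notMem_image_support hν' hζ), zero_add, hβ, Complex.conj_ofReal]
  obtain ⟨c, hc⟩ := h.compression y
  set Y := r + (β * (w - ζ)) • J y with hY
  -- `(ζ - t) Y` is a scalar multiple `d` of the constant function.
  obtain ⟨d, hd⟩ : ∃ d : ℂ, ζ • Y - posOp ν Y = d • one ν := by
    refine ⟨(markov ν w)⁻¹ + (ζ - w) - β * (w - ζ) * c, ?_⟩
    have h1 : one ν = r - β • J (one ν') := by rw [hr, ← h.one_add]; abel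
    have h2 : ζ • Y - posOp ν Y =
        (ζ - w) • (r - β • J (one ν')) + ((markov ν w)⁻¹ - β * (w - ζ) * c) • one ν := by
      rw [hY, map_add, map_smul, hTr, hc, hTy, map_sub, map_smul]
      module
    rw [h2, ← h1, ← add_smul]
    congr 1
    ring
  have hY1 : ⟪one ν, Y⟫_ℂ = 1 := by
    rw [hY, inner_add_right, inner_smul_right, h.orthogonal, mul_zero, add_zero,
      inner_one_resVec hν hw]
  have hYd : Y = d • resOp ν ζ (one ν) := by
    have h3 := congrArg (fun P : Lp ℂ 2 ν →L[ℂ] Lp ℂ 2 ν => P Y)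
      (resOp_mul hν (notMem_image_support hν hζ))
    simp only [mul_apply_eq_comp, one_apply_eq_self, _root_.sub_apply, _root_.smul_apply] at h3
    rw [hd, map_smul] at h3
    exact h3.symm
  have hdφ : d * markov ν ζ = 1 := by
    rw [← hY1, hYd, inner_smul_right, inner_one_resOp_one (notMem_image_support hν hζ)]
  have hd2 : d = ζ * (diagB ν w : ℂ) - (diagA ν w : ℂ)
      - β ^ 2 * (ζ - w) * (ζ - conj w) * markov ν' ζ := by
    have h4 : ⟪r, ζ • Y - posOp ν Y⟫_ℂ = d := by
      rw [hd, inner_smul_right, hr1, mul_one]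
    have h5 : ⟪r, posOp ν (J y)⟫_ℂ = conj w * (β * markov ν' ζ) := by
      rw [← inner_posOp_left hν, hTr, inner_sub_left, inner_smul_left, inner_smul_left,
        h.orthogonal, hrJ, mul_zero, sub_zero]
    rw [← h4, hY, inner_sub_right, inner_smul_right, map_add, map_smul, inner_add_right,
      inner_add_right, inner_smul_right, inner_smul_right, hrJ, h5, hr, inner_resVec_self hν hw,
      inner_resVec_posOp hν hw]
    ring
  rw [← hd2]
  exact eq_one_div_of_mul_eq_one_right hdφ

end IsStep

end

section

variable {ν ν' : Measure ℝ} {a b : ℝ}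

/-! ### A measure is determined by its Markov function -/

lemma exists_abs_bound (a b : ℝ) : ∃ M : ℝ, 0 < M ∧ ∀ t ∈ Set.Icc a b, |t| ≤ M :=
  ⟨max |a| |b| + 1, by positivity, fun _ ht => (abs_le_max_abs_abs ht.1 ht.2).trans (by linarith)⟩

lemma notMem_cSegment_of_norm {M : ℝ} (hM : ∀ t ∈ Set.Icc a b, |t| ≤ M) {ζ : ℂ} (hζ : M < ‖ζ‖) :
    ζ ∉ cSegment a b := by
  rintro ⟨t, ht, rfl⟩
  rw [Complex.norm_real] at hζ
  exact (hM t ht).not_gt hζ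

/-- The moments are the limits at infinity of `ζ ∫ tᵏ / (ζ - t) dν(t)`. -/
lemma tendsto_mul_integral_resolvent [IsProbabilityMeasure ν] (hν : ν (Set.Icc a b)ᶜ = 0) (k : ℕ) :
    Tendsto (fun ζ : ℂ => ζ * ∫ t, (t : ℂ) ^ k * (1 / (ζ - t)) ∂ν) (Bornology.cobounded ℂ)
      (𝓝 (∫ t, (t : ℂ) ^ k ∂ν)) := by
  obtain ⟨M, hM, hb⟩ := exists_abs_bound a b
  simp_rw [← integral_const_mul]
  have hcg : (Bornology.cobounded ℂ).IsCountablyGenerated := by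
    rw [← comap_norm_atTop]
    infer_instance
  refine tendsto_integral_filter_of_dominated_convergence (fun _ => 2 * M ^ k) ?_ ?_
    (integrable_const _) ?_
  · refine Eventually.of_forall fun ζ => Measurable.aestronglyMeasurable ?_
    exact measurable_const.mul ((Complex.measurable_ofReal.pow_const k).mul
      (measurable_const.div (measurable_const.sub Complex.measurable_ofReal)))
  · filter_upwards [tendsto_norm_cobounded_atTop.eventually_ge_atTop (2 * M)] with ζ hζ
    filter_upwards [ae_mem_Icc hν] with t ht
    have h1 : ‖(t : ℂ)‖ ≤ M := by rw [Complex.norm_real]; exact hb t ht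
    have h2 : ‖ζ‖ / 2 ≤ ‖ζ - t‖ := by
      have := norm_sub_norm_le ζ t
      linarith
    have h3 : ‖ζ‖ / ‖ζ - t‖ ≤ 2 := by
      rw [div_le_iff₀ (by linarith)]
      linarith
    calc ‖ζ * ((t : ℂ) ^ k * (1 / (ζ - t)))‖ = ‖ζ‖ / ‖ζ - t‖ * ‖(t : ℂ)‖ ^ k := by
          rw [norm_mul, norm_mul, norm_div, norm_one, norm_pow]; ring
      _ ≤ 2 * M ^ k := by gcongr
  · refine Eventually.of_forall fun t => ?_
    have h1 : Tendsto (fun ζ : ℂ => (t : ℂ) * (ζ - t)⁻¹) (Bornology.cobounded ℂ) (𝓝 0) := by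
      have h2 : Tendsto (fun ζ : ℂ => ζ - t) (Bornology.cobounded ℂ) (Bornology.cobounded ℂ) :=
        tendsto_sub_const_cobounded _
      simpa using (tendsto_inv₀_cobounded.comp h2).const_mul (t : ℂ)
    have h3 : Tendsto (fun ζ : ℂ => (t : ℂ) ^ k * (1 + (t : ℂ) * (ζ - t)⁻¹))
        (Bornology.cobounded ℂ) (𝓝 ((t : ℂ) ^ k)) := by
      simpa using (h1.const_add 1).const_mul ((t : ℂ) ^ k)
    refine h3.congr' ?_
    filter_upwards [tendsto_norm_cobounded_atTop.eventually_gt_atTop ‖(t : ℂ)‖] with ζ hζ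
    have h4 : ζ - t ≠ 0 := by
      rw [sub_ne_zero]
      rintro rfl
      exact lt_irrefl _ hζ
    field_simp
    ring

lemma integral_pow_eq_of_markov_eq [IsProbabilityMeasure ν] [IsProbabilityMeasure ν']
    (hν : ν (Set.Icc a b)ᶜ = 0) (hν' : ν' (Set.Icc a b)ᶜ = 0)
    (h : ∀ᶠ ζ in Bornology.cobounded ℂ, markov ν ζ = markov ν' ζ) (k : ℕ) :
    ∫ t, (t : ℂ) ^ k ∂ν = ∫ t, (t : ℂ) ^ k ∂ν' := by
  have hlim : ∀ k : ℕ, (∀ᶠ ζ : ℂ in Bornology.cobounded ℂ,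
      ∫ t, (t : ℂ) ^ k * (1 / (ζ - t)) ∂ν = ∫ t, (t : ℂ) ^ k * (1 / (ζ - t)) ∂ν') →
      ∫ t, (t : ℂ) ^ k ∂ν = ∫ t, (t : ℂ) ^ k ∂ν' := fun k hk =>
    tendsto_nhds_unique ((tendsto_mul_integral_resolvent hν k).congr'
      (hk.mono fun ζ hζ => by rw [hζ])) (tendsto_mul_integral_resolvent hν' k)
  refine hlim k ?_
  obtain ⟨M, -, hb⟩ := exists_abs_bound a b
  -- `tᵏ⁺¹ / (ζ - t) = ζ tᵏ / (ζ - t) - tᵏ`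
  have hstep : ∀ (ρ : Measure ℝ) [IsProbabilityMeasure ρ], ρ (Set.Icc a b)ᶜ = 0 → ∀ ζ : ℂ,
      ζ ∉ cSegment a b → ∀ k : ℕ, ∫ t, (t : ℂ) ^ (k + 1) * (1 / (ζ - t)) ∂ρ
        = ζ * ∫ t, (t : ℂ) ^ k * (1 / (ζ - t)) ∂ρ - ∫ t, (t : ℂ) ^ k ∂ρ := by
    intro ρ _ hρ ζ hζ k
    have h1 := (memLp_resolvent (notMem_image_support hρ hζ)).mul' (memLp_pow hρ k) (r := ∞)
    rw [← integral_const_mul, ← integral_sub ((h1.integrable le_top).const_mul ζ)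
      ((memLp_pow hρ k).integrable le_top)]
    refine integral_congr_ae ?_
    filter_upwards [ae_mem_Icc hρ] with t ht
    have h4 : ζ - t ≠ 0 := by
      rw [sub_ne_zero]
      rintro rfl
      exact hζ ⟨t, ht, rfl⟩
    field_simp
    ring
  induction k with
  | zero => simpa [markov] using h
  | succ k ih =>
    filter_upwards [ih, tendsto_norm_cobounded_atTop.eventually_gt_atTop M] with ζ h1 h2
    have h3 := notMem_cSegment_of_norm hb h2
    rw [hstep ν hν ζ h3, hstep ν' hν' ζ h3, h1, hlim k ih]

/-- Measures on a compact interval are determined by their moments (Weierstrass). -/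
lemma eq_of_moments_eq [IsProbabilityMeasure ν] [IsProbabilityMeasure ν']
    (hν : ν (Set.Icc a b)ᶜ = 0) (hν' : ν' (Set.Icc a b)ᶜ = 0)
    (h : ∀ k : ℕ, ∫ t, (t : ℂ) ^ k ∂ν = ∫ t, (t : ℂ) ^ k ∂ν') : ν = ν' := by
  have hint : ∀ (ρ : Measure ℝ) [IsProbabilityMeasure ρ], ρ (Set.Icc a b)ᶜ = 0 →
      ∀ p : Polynomial ℝ, Integrable (fun t => p.eval t) ρ := by
    intro ρ _ hρ p
    obtain ⟨C, hC⟩ := isCompact_Icc.exists_bound_of_continuousOn (s := Set.Icc a b)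
      (f := fun t : ℝ => p.eval t) (by fun_prop)
    refine Integrable.of_bound (by fun_prop) C ?_
    filter_upwards [ae_mem_Icc hρ] with t ht using hC t ht
  have hpow : ∀ k : ℕ, ∫ t, t ^ k ∂ν = ∫ t, t ^ k ∂ν' := by
    intro k
    have h1 := h k
    simp only [← Complex.ofReal_pow, integral_complex_ofReal] at h1
    exact_mod_cast h1
  have hpoly : ∀ p : Polynomial ℝ, ∫ t, p.eval t ∂ν = ∫ t, p.eval t ∂ν' := by
    intro p
    induction p using Polynomial.induction_on' with
    | add p q hp hq =>
      simp only [Polynomial.eval_add]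
      rw [integral_add (hint ν hν p) (hint ν hν q), integral_add (hint ν' hν' p) (hint ν' hν' q),
        hp, hq]
    | monomial n c =>
      simp only [Polynomial.eval_monomial, integral_const_mul, hpow]
  refine ext_of_forall_integral_eq_of_IsFiniteMeasure fun f => ?_
  refine eq_of_forall_dist_le fun ε hε => ?_
  obtain ⟨p, hp⟩ := exists_polynomial_near_of_continuousOn a b f (by fun_prop) (ε / 2)
    (by positivity)
  have hnear : ∀ (ρ : Measure ℝ) [IsProbabilityMeasure ρ], ρ (Set.Icc a b)ᶜ = 0 →
      dist (∫ t, f t ∂ρ) (∫ t, p.eval t ∂ρ) ≤ ε / 2 := by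
    intro ρ _ hρ
    rw [dist_comm, dist_eq_norm, ← integral_sub (hint ρ hρ p) (f.integrable ρ)]
    refine (norm_integral_le_of_norm_le_const (C := ε / 2) ?_).trans (by simp)
    filter_upwards [ae_mem_Icc hρ] with t ht using (hp t ht).le
  have h1 := hnear ν hν
  have h2 := hnear ν' hν'
  rw [hpoly] at h1
  rw [dist_comm] at h2
  linarith [dist_triangle (∫ t, f t ∂ν) (∫ t, p.eval t ∂ν') (∫ t, f t ∂ν')]

lemma eq_of_markov_eq [IsProbabilityMeasure ν] [IsProbabilityMeasure ν']
    (hν : ν (Set.Icc a b)ᶜ = 0) (hν' : ν' (Set.Icc a b)ᶜ = 0)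
    (h : ∀ᶠ ζ in Bornology.cobounded ℂ, markov ν ζ = markov ν' ζ) : ν = ν' :=
  eq_of_moments_eq hν hν' (integral_pow_eq_of_markov_eq hν hν' h)

/-- The recurrence determines the successor of a measure with infinite-dimensional `L²`, so that
every successor arises from an isometry as in `IsStep`. -/
lemma exists_isStep_of_recurrence [IsProbabilityMeasure ν] [IsProbabilityMeasure ν']
    (hν : ν (Set.Icc a b)ᶜ = 0) (hν' : ν' (Set.Icc a b)ᶜ = 0) {w : ℂ} (hw : w ∉ cSegment a b)
    (hinf : ¬ FiniteDimensional ℂ (Lp ℂ 2 ν))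
    (hrec : ∀ ζ : ℂ, ζ ∉ cSegment a b → markov ν ζ = 1 / (ζ * (diagB ν w : ℂ) - (diagA ν w : ℂ)
      - (offB ν w : ℂ) ^ 2 * (ζ - w) * (ζ - conj w) * markov ν' ζ)) :
    ∃ J : Lp ℂ 2 ν' →ₗᵢ[ℂ] Lp ℂ 2 ν, IsStep ν ν' w J := by
  obtain ⟨ρ, hprob, hρ, J, hJ⟩ := exists_isStep hν hw hinf
  obtain ⟨M, -, hb⟩ := exists_abs_bound a b
  have hoff : (offB ν w : ℂ) ≠ 0 := by exact_mod_cast offB_ne_zero hν hw hinf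
  have hρν : ρ = ν' := by
    refine eq_of_markov_eq hρ hν' ?_
    filter_upwards [tendsto_norm_cobounded_atTop.eventually_gt_atTop M,
      tendsto_norm_cobounded_atTop.eventually_gt_atTop ‖w‖] with ζ h1 h2
    have hζ := notMem_cSegment_of_norm hb h1
    have h3 : ζ - w ≠ 0 := by
      rw [sub_ne_zero]
      rintro rfl
      exact lt_irrefl _ h2
    have h4 : ζ - conj w ≠ 0 := by
      rw [sub_ne_zero]
      rintro rfl
      rw [RCLike.norm_conj] at h2
      exact lt_irrefl _ h2
    have h5 := (hJ.recurrence hν hρ hw hζ).symm.trans (hrec ζ hζ)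
    rw [one_div, one_div, inv_inj, sub_right_inj] at h5
    exact mul_left_cancel₀ (mul_ne_zero (mul_ne_zero (pow_ne_zero 2 hoff) h3) h4) h5
  subst hρν
  exact ⟨J, hJ⟩

/-! ### The support of the measure -/

/-- If `L²(ν)` were finite-dimensional, then by the Cayley–Hamilton theorem a nonzero polynomial
would vanish `ν`-almost everywhere, and the support would consist of some of its roots. -/
lemma infiniteDimensional_of_infinite_support [IsProbabilityMeasure ν]
    (hν : ν (Set.Icc a b)ᶜ = 0) (hinf : ν.support.Infinite) :
    ¬ FiniteDimensional ℂ (Lp ℂ 2 ν) := by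
  intro hfin
  let Φ : (Lp ℂ 2 ν →L[ℂ] Lp ℂ 2 ν) →ₐ[ℂ] Module.End ℂ (Lp ℂ 2 ν) :=
    { ContinuousLinearMap.toLinearMapRingHom with commutes' := fun _ => rfl }
  let T : Module.End ℂ (Lp ℂ 2 ν) := (posOp ν).toLinearMap
  set p := T.charpoly with hp
  have hp0 : p ≠ 0 := T.charpoly_monic.ne_zero
  have hTp : mulOp ν (fun t => p.eval (t : ℂ)) (one ν) = 0 := by
    have h1 : Polynomial.aeval T p (one ν) = 0 := by
      rw [hp, LinearMap.aeval_self_charpoly]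
      rfl
    rw [← aeval_posOp hν, ← h1]
    exact (congrArg (fun P : Module.End ℂ (Lp ℂ 2 ν) => P (one ν))
      (Polynomial.aeval_algHom_apply Φ (posOp ν) p)).symm
  have hae : ∀ᵐ t ∂ν, t ∈ {t : ℝ | p.IsRoot (t : ℂ)} := by
    have h2 := mulOp_one_ae (memLp_poly hν p)
    rw [hTp] at h2
    filter_upwards [h2, Lp.coeFn_zero ℂ 2 ν] with t h3 h4
    rw [h4] at h3
    exact h3.symm
  have hcl : IsClosed {t : ℝ | p.IsRoot (t : ℂ)} :=
    isClosed_eq (by fun_prop) continuous_const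
  refine hinf (Set.Finite.subset ?_ (Measure.support_subset_of_isClosed hcl hae))
  exact (Polynomial.finite_setOfPred_isRoot hp0).preimage Complex.ofReal_injective.injOn

/-- The spectrum of multiplication by `t` on `L²(ν)` is the support of `ν`. -/
lemma isUnit_sub_posOp_iff [IsProbabilityMeasure ν] (hν : ν (Set.Icc a b)ᶜ = 0) (ζ : ℂ) :
    IsUnit (ζ • 1 - posOp ν) ↔ ζ ∉ (fun t : ℝ => (t : ℂ)) '' ν.support := by
  refine ⟨?_, fun hζ => isUnit_iff_exists.2 ⟨_, mul_resOp hν hζ, resOp_mul hν hζ⟩⟩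
  rintro ⟨u, hu⟩ ⟨t₀, ht₀, rfl⟩
  -- The indicator `f` of the ball of radius `ε` around `t₀` satisfies `‖(t₀ - t) f‖ ≤ ε ‖f‖`, which
  -- contradicts the bound `‖R‖` on the inverse when `‖R‖ ε < 1`.
  set R : Lp ℂ 2 ν →L[ℂ] Lp ℂ 2 ν := ↑u⁻¹ with hR
  set ε : ℝ := (‖R‖ + 1)⁻¹ with hε
  have hεpos : 0 < ε := by positivity
  set f : Lp ℂ 2 ν := indicatorConstLp 2 (Metric.isOpen_ball (x := t₀) (ε := ε)).measurableSet
    (measure_ne_top ν _) (1 : ℂ) with hf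
  have hpos : 0 < ν (Metric.ball t₀ ε) :=
    (Measure.mem_support_iff_forall t₀).1 ht₀ _ (Metric.ball_mem_nhds t₀ hεpos)
  have hfpos : 0 < ‖f‖ := by
    rw [hf, norm_indicatorConstLp (by norm_num) (by norm_num), norm_one, one_mul]
    exact Real.rpow_pos_of_pos (ENNReal.toReal_pos hpos.ne' (measure_ne_top ν _)) _
  have h1 : ‖(u : Lp ℂ 2 ν →L[ℂ] Lp ℂ 2 ν) f‖ ≤ ε * ‖f‖ := by
    refine Lp.norm_le_mul_norm_of_ae_le_mul ?_
    rw [hu, smul_one_sub_posOp hν]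
    filter_upwards [mulOp_apply_ae (ν := ν) ((memLp_const ((t₀ : ℝ) : ℂ)).sub (memLp_id hν)) f,
      indicatorConstLp_coeFn (p := 2) (hs := (Metric.isOpen_ball (x := t₀) (ε := ε)).measurableSet)
        (hμs := measure_ne_top ν _) (c := (1 : ℂ))] with t h2 h3
    refine (congrArg norm h2).trans_le ?_
    rw [hf, h3]
    by_cases ht : t ∈ Metric.ball t₀ ε
    · rw [Set.indicator_of_mem ht, norm_mul, norm_one, mul_one, mul_one]
      rw [Metric.mem_ball, dist_comm, Real.dist_eq] at ht
      rw [Pi.sub_apply, ← Complex.ofReal_sub, Complex.norm_real]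
      exact ht.le
    · simp [Set.indicator_of_notMem ht]
  have h2 : R ((u : Lp ℂ 2 ν →L[ℂ] Lp ℂ 2 ν) f) = f := by
    rw [← mul_apply_eq_comp, hR, u.inv_mul, one_apply_eq_self]
  have h3 : ‖f‖ ≤ ‖R‖ * (ε * ‖f‖) := by
    calc ‖f‖ = ‖R ((u : Lp ℂ 2 ν →L[ℂ] Lp ℂ 2 ν) f)‖ := by rw [h2]
      _ ≤ ‖R‖ * ‖(u : Lp ℂ 2 ν →L[ℂ] Lp ℂ 2 ν) f‖ := R.le_opNorm _
      _ ≤ ‖R‖ * (ε * ‖f‖) := by gcongr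
  have h4 : ‖R‖ * ε < 1 := by
    rw [hε, ← div_eq_mul_inv, div_lt_one (by positivity)]
    linarith
  nlinarith

/-! ### Decay of the off-diagonal entries -/

/-- As `w → ∞`, the normalized resolvent `(w - t)⁻¹ / φ(w)` tends to `1`, uniformly over all
probability measures on `[a, b]`. -/
lemma offB_le [IsProbabilityMeasure ν] (hν : ν (Set.Icc a b)ᶜ = 0) {M : ℝ} (hM : 0 < M)
    (hb : ∀ t ∈ Set.Icc a b, |t| ≤ M) {w : ℂ} (hw : 3 * M ≤ ‖w‖) :
    offB ν w ≤ 6 * M / ‖w‖ := by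
  have hseg : w ∉ cSegment a b := notMem_cSegment_of_norm hb (by linarith)
  have hw0 : 0 < ‖w‖ := by linarith
  have hw0' : w ≠ 0 := norm_pos_iff.1 hw0
  have hR := memLp_resolvent (notMem_image_support hν hseg)
  -- `ε` bounds `t / (w - t) = w / (w - t) - 1` on `[a, b]`.
  set ε : ℝ := 3 * M / (2 * ‖w‖) with hε
  have hε2 : ε ≤ 1 / 2 := by
    rw [hε, div_le_iff₀ (by positivity)]
    linarith
  set s : Lp ℂ 2 ν := w • resOp ν w (one ν) with hs
  have hs1 : ‖s - one ν‖ ≤ ε := by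
    have h1 : s - one ν = posOp ν (resOp ν w (one ν)) := (resOp_one_spec hν hseg).symm
    rw [h1]
    refine (Lp.norm_le_of_ae_bound (C := ε) (by positivity) ?_).trans (by simp [measureUnivNNReal])
    filter_upwards [mulOp_apply_ae (memLp_id hν) (resOp ν w (one ν)), mulOp_one_ae hR,
      ae_mem_Icc hν] with t h2 h3 h4
    have h5 : ‖(t : ℂ)‖ ≤ M := by rw [Complex.norm_real]; exact hb t h4
    have h6 : 2 * ‖w‖ / 3 ≤ ‖w - t‖ := by
      have := norm_sub_norm_le w t
      linarith
    rw [h2, h3, mul_one_div, norm_div, hε]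
    calc ‖(t : ℂ)‖ / ‖w - t‖ ≤ M / (2 * ‖w‖ / 3) := by gcongr
      _ = 3 * M / (2 * ‖w‖) := by field_simp
  have hinner : ⟪one ν, s⟫_ℂ = w * markov ν w := by
    rw [hs, inner_smul_right, inner_one_resOp_one (notMem_image_support hν hseg)]
  set c : ℂ := w * markov ν w with hc
  have hc1 : ‖c - 1‖ ≤ ε := by
    have h1 : c - 1 = ⟪one ν, s - one ν⟫_ℂ := by rw [inner_sub_right, hinner, inner_one_one]
    rw [h1]
    refine (norm_inner_le_norm _ _).trans ?_
    rwa [norm_one_eq, one_mul]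
  have hc2 : 1 / 2 ≤ ‖c‖ := by
    have h1 := norm_sub_norm_le (1 : ℂ) (1 - c)
    rw [sub_sub_cancel, norm_one, norm_sub_rev] at h1
    linarith
  have hr : c • (resVec ν w - one ν) = (s - one ν) - (c - 1) • one ν := by
    have h1 : c • resVec ν w = s := by
      rw [resVec, hs, smul_smul, hc, mul_assoc, mul_inv_cancel₀ (markov_ne_zero hν hseg), mul_one]
    rw [smul_sub, h1, sub_smul, one_smul]
    abel
  have h1 : ‖c‖ * offB ν w ≤ 2 * ε := by
    rw [offB_eq_norm hν hseg, ← norm_smul, hr]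
    refine (norm_sub_le _ _).trans ?_
    rw [norm_smul, norm_one_eq, mul_one]
    linarith
  have h2 : 0 ≤ offB ν w := Real.sqrt_nonneg _
  have h3 : 6 * M / ‖w‖ = 4 * ε := by rw [hε]; field_simp; ring
  rw [h3]
  nlinarith

end

/-! ### Operators on `ℓ²` -/

lemma inner_e (j : ℕ) (x : Ell2) : ⟪e j, x⟫_ℂ = x j := by
  rw [e, lp.inner_single_left]
  simp

lemma orthonormal_e : Orthonormal ℂ e := by
  rw [orthonormal_iff_ite]
  intro i j
  rw [inner_e, e, lp.single_apply, Pi.single_apply]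

lemma hasSum_smul_e (x : Ell2) : HasSum (fun j => x j • e j) x := by
  have h := lp.hasSum_single (p := 2) (by norm_num) x
  convert h using 2 with j
  rw [e, ← lp.single_smul, smul_eq_mul, mul_one]

/-- Every bounded operator on `ℓ²` acts by the matrix product with its matrix of entries. -/
lemma hasSum_entries (T : Ell2 →L[ℂ] Ell2) (x : Ell2) (i : ℕ) :
    HasSum (fun j => ⟪e i, T (e j)⟫_ℂ * x j) (T x i) := by
  have h := (hasSum_smul_e x).mapL ((innerSL ℂ (e i)) ∘L T)
  have h2 : (innerSL ℂ (e i) ∘L T) x = T x i := inner_e i _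
  rw [h2] at h
  have h3 : (fun j => ⟪e i, T (e j)⟫_ℂ * x j)
      = fun j => (innerSL ℂ (e i) ∘L T) (x j • e j) := funext fun j => by
    rw [map_smul, smul_eq_mul, mul_comm]
    rfl
  rw [h3]
  exact h

lemma mem_of_forall_e_mem {M : Submodule ℂ Ell2} (hM : IsClosed (M : Set Ell2))
    (h : ∀ j, e j ∈ M) (x : Ell2) : x ∈ M :=
  hM.mem_of_tendsto (hasSum_smul_e x)
    (Eventually.of_forall fun _ => M.sum_mem fun j _ => M.smul_mem _ (h j))

/-- The isometry of `ℓ²` into a Hilbert space that maps the canonical basis to a given orthonormal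
sequence. -/
lemma exists_linearIsometry_of_orthonormal {H : Type*} [NormedAddCommGroup H]
    [InnerProductSpace ℂ H] [CompleteSpace H] {v : ℕ → H} (hv : Orthonormal ℂ v) :
    ∃ U : Ell2 →ₗᵢ[ℂ] H, ∀ j, U (e j) = v j :=
  ⟨hv.orthogonalFamily.linearIsometry, fun j => by
    rw [e, OrthogonalFamily.linearIsometry_apply_single]
    simp⟩

lemma isCompactOperator_rankOne (c : ℂ) (u v : Ell2) :
    IsCompactOperator (c • (innerSL ℂ u).smulRight v : Ell2 →L[ℂ] Ell2) := by
  refine IsCompactOperator.smul ?_ c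
  have h : IsCompactOperator (ContinuousLinearMap.toSpanSingleton ℂ v) :=
    isCompactOperator_of_locallyCompactSpace_rng _
  exact h.comp_clm (innerSL ℂ u)

/-- A diagonal operator whose entries tend to zero is compact. -/
lemma exists_diagonal {c : ℕ → ℝ} (hc : Tendsto c atTop (𝓝 0)) :
    ∃ D : Ell2 →L[ℂ] Ell2, (∀ x j, D x j = c j * x j) ∧ IsCompactOperator D := by
  obtain ⟨C, hC⟩ := hc.norm.bddAbove_range
  have hC' : ∀ j, ‖c j‖ ≤ C := fun j => hC ⟨j, rfl⟩
  have hC0 : 0 ≤ C := (norm_nonneg _).trans (hC' 0)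
  have hnorm : ∀ r : ℝ, ‖((r : ℂ) • ContinuousLinearMap.id ℂ ℂ)‖ ≤ ‖r‖ := fun r => by
    rw [norm_smul, Complex.norm_real]
    exact mul_le_of_le_one_right (norm_nonneg _) ContinuousLinearMap.norm_id_le
  let D : Ell2 →L[ℂ] Ell2 := lp.mapCLM 2 (fun j => (c j : ℂ) • ContinuousLinearMap.id ℂ ℂ) hC0
    fun j => (hnorm _).trans (hC' j)
  have hD : ∀ x j, D x j = c j * x j := fun x j => rfl
  refine ⟨D, hD, ?_⟩
  -- The finite-rank truncations converge to `D` in norm.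
  let Dn : ℕ → Ell2 →L[ℂ] Ell2 := fun n =>
    ∑ j ∈ Finset.range n, (c j : ℂ) • (innerSL ℂ (e j)).smulRight (e j)
  have hDn : ∀ n, IsCompactOperator (Dn n) := by
    intro n
    exact (compactOperator (RingHom.id ℂ) Ell2 Ell2).sum_mem
      fun j _ => isCompactOperator_rankOne _ _ _
  have hDn_apply : ∀ n x i, Dn n x i = if i < n then (c i : ℂ) * x i else 0 := by
    intro n x i
    have h1 : Dn n x = ∑ j ∈ Finset.range n, ((c j : ℂ) * x j) • e j := by
      rw [_root_.sum_apply]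
      refine Finset.sum_congr rfl fun j _ => ?_
      rw [_root_.smul_apply, ContinuousLinearMap.smulRight_apply, innerSL_apply_apply, inner_e,
        smul_smul]
    rw [h1, ← inner_e, inner_sum]
    simp_rw [inner_smul_right, orthonormal_iff_ite.1 orthonormal_e]
    simp
  refine isCompactOperator_of_tendsto (F := Dn) (l := atTop) ?_ (Eventually.of_forall hDn)
  rw [tendsto_iff_norm_sub_tendsto_zero, Metric.tendsto_atTop]
  intro ε hε
  obtain ⟨N, hN⟩ := Metric.tendsto_atTop.1 hc (ε / 2) (by positivity)
  refine ⟨N, fun n hn => ?_⟩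
  have hb : ∀ j, ‖(((if j < n then 0 else -c j : ℝ) : ℂ) • ContinuousLinearMap.id ℂ ℂ)‖
      ≤ ε / 2 := by
    intro j
    refine (hnorm _).trans ?_
    split_ifs with h
    · simpa using (half_pos hε).le
    · have := hN j (by omega)
      rw [Real.dist_eq, sub_zero] at this
      rw [norm_neg]
      exact this.le
  have heq : Dn n - D = lp.mapCLM 2 _ (by positivity) hb := by
    ext x j
    change Dn n x j - D x j = ((if j < n then 0 else -c j : ℝ) : ℂ) * x j
    rw [hDn_apply, hD]
    split_ifs <;> simp
  have h1 := lp.norm_mapCLM_le 2 _ (by positivity : 0 ≤ ε / 2) hb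
  rw [← heq] at h1
  rw [Real.dist_eq, sub_zero, abs_norm]
  linarith

/-- The weighted shift `e j ↦ c j e (j + 1)` with weights tending to zero is compact, as is its
adjoint. -/
lemma exists_weightedShift {c : ℕ → ℝ} (hc : Tendsto c atTop (𝓝 0)) :
    ∃ W : Ell2 →L[ℂ] Ell2, (∀ j, W (e j) = (c j : ℂ) • e (j + 1)) ∧ IsCompactOperator W ∧
      IsCompactOperator (ContinuousLinearMap.adjoint W) := by
  obtain ⟨D, hD, hDc⟩ := exists_diagonal hc
  obtain ⟨Sh, hSh⟩ := exists_linearIsometry_of_orthonormal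
    (orthonormal_e.comp (fun j : ℕ => j + 1) (add_left_injective 1))
  have hDe : ∀ j, D (e j) = (c j : ℂ) • e j := by
    intro j
    ext i
    rw [hD, lp.coeFn_smul, Pi.smul_apply, smul_eq_mul, e, lp.single_apply, Pi.single_apply]
    split_ifs with h
    · rw [h]
    · simp
  have hDadj : ContinuousLinearMap.adjoint D = D := by
    symm
    rw [ContinuousLinearMap.eq_adjoint_iff]
    intro x y
    rw [lp.inner_eq_tsum, lp.inner_eq_tsum]
    refine tsum_congr fun j => ?_
    rw [hD, hD]
    simp only [RCLike.inner_apply, map_mul, Complex.conj_ofReal]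
    ring
  refine ⟨Sh.toContinuousLinearMap ∘L D, fun j => ?_, hDc.clm_comp _, ?_⟩
  · rw [ContinuousLinearMap.comp_apply, hDe, map_smul]
    congr 1
    exact hSh j
  · rw [ContinuousLinearMap.adjoint_comp, hDadj]
    exact hDc.comp_clm _

/-- The lower bidiagonal operator `1 + W`, with `W` a weighted shift whose weights tend to zero, is
invertible: it is an injective compact perturbation of the identity. -/
lemma isUnit_one_add_weightedShift {c : ℕ → ℝ} {W : Ell2 →L[ℂ] Ell2}
    (hW : ∀ j, W (e j) = (c j : ℂ) • e (j + 1)) (hWc : IsCompactOperator W) :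
    IsUnit (1 + W) := by
  have hentry : ∀ i j, ⟪e i, W (e j)⟫_ℂ = if i = j + 1 then (c j : ℂ) else 0 := by
    intro i j
    rw [hW, inner_smul_right, orthonormal_iff_ite.1 orthonormal_e]
    simp
  have hW0 : ∀ x, W x 0 = 0 := by
    intro x
    refine (hasSum_entries W x 0).unique ?_
    simp only [hentry]
    simp
  have hWs : ∀ x i, W x (i + 1) = c i * x i := by
    intro x i
    refine (hasSum_entries W x (i + 1)).unique ?_
    simp only [hentry]
    convert hasSum_single i ?_ using 1
    · simp
    · intro j hj
      rw [if_neg (by omega), zero_mul]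
  rcases hWc.hasEigenvalue_or_mem_resolventSet (μ := (-1 : ℂ)) (by norm_num) with h | h
  · exfalso
    obtain ⟨x, hx⟩ := h.exists_hasEigenvector
    have hx1 : W x = -x := by simpa using hx.apply_eq_smul
    refine hx.2 (lp.ext (funext fun i => ?_))
    induction i with
    | zero =>
      have h := hW0 x
      rw [hx1] at h
      simpa using h
    | succ i ih =>
      have h := hWs x i
      rw [hx1, ih] at h
      simpa using h
  · rw [spectrum.mem_resolventSet_iff] at h
    have h2 : algebraMap ℂ (Ell2 →L[ℂ] Ell2) (-1) - W = -(1 + W) := by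
      rw [map_neg, map_one]
      abel
    rw [h2] at h
    exact (IsUnit.neg_iff _).1 h

/-! ### The orthonormal sequence of rational functions -/

section Tower

variable {ν : ℕ → Measure ℝ}

/-- The composition `J 0 ∘ ⋯ ∘ J (j - 1)`, which embeds `L²(ν j)` into `L²(ν 0)`. -/
noncomputable def embed (J : ∀ j, Lp ℂ 2 (ν (j + 1)) →ₗᵢ[ℂ] Lp ℂ 2 (ν j)) :
    ∀ j, Lp ℂ 2 (ν j) →ₗᵢ[ℂ] Lp ℂ 2 (ν 0)
  | 0 => LinearIsometry.id
  | j + 1 => (embed J j).comp (J j)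

variable {J : ∀ j, Lp ℂ 2 (ν (j + 1)) →ₗᵢ[ℂ] Lp ℂ 2 (ν j)}

lemma exists_embed_eq {i j : ℕ} (hij : i + 1 ≤ j) (f : Lp ℂ 2 (ν j)) :
    ∃ g, embed J j f = embed J i (J i g) := by
  induction j, hij using Nat.le_induction with
  | base => exact ⟨f, rfl⟩
  | succ j _ ih => exact ih (J j f)

variable [∀ j, IsProbabilityMeasure (ν j)]

/-- The images of the constant functions under the embeddings: an orthonormal sequence of rational
functions in `L²(ν 0)`, starting with the constant `1`. -/
noncomputable def ratVec (J : ∀ j, Lp ℂ 2 (ν (j + 1)) →ₗᵢ[ℂ] Lp ℂ 2 (ν j)) (j : ℕ) :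
    Lp ℂ 2 (ν 0) :=
  embed J j (one (ν j))

variable {w : ℕ → ℂ}

lemma inner_ratVec_embed (hJ : ∀ j, IsStep (ν j) (ν (j + 1)) (w j) (J j)) {i j : ℕ} (hij : i < j)
    (f : Lp ℂ 2 (ν j)) : ⟪ratVec J i, embed J j f⟫_ℂ = 0 := by
  obtain ⟨g, hg⟩ := exists_embed_eq (J := J) hij f
  rw [hg, ratVec, LinearIsometry.inner_map_map, (hJ i).orthogonal]

lemma orthonormal_ratVec (hJ : ∀ j, IsStep (ν j) (ν (j + 1)) (w j) (J j)) :
    Orthonormal ℂ (ratVec J) := by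
  refine ⟨fun j => by rw [ratVec, LinearIsometry.norm_map, norm_one_eq], fun i j hij => ?_⟩
  rcases lt_or_gt_of_ne hij with h | h
  · exact inner_ratVec_embed hJ h _
  · change ⟪ratVec J i, ratVec J j⟫_ℂ = 0
    rw [← inner_conj_symm, show ratVec J i = embed J i (one (ν i)) from rfl,
      inner_ratVec_embed hJ h, map_zero]

lemma embed_resVec (hJ : ∀ j, IsStep (ν j) (ν (j + 1)) (w j) (J j)) (j : ℕ) :
    embed J j (resVec (ν j) (w j)) =
      ratVec J j + (offB (ν j) (w j) : ℂ) • ratVec J (j + 1) := by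
  rw [← (hJ j).one_add, map_add, map_smul]
  rfl

/-- Multiplication by `t` commutes with the embeddings up to the preceding rational functions. -/
lemma posOp_embed (hJ : ∀ j, IsStep (ν j) (ν (j + 1)) (w j) (J j)) (j : ℕ) (f : Lp ℂ 2 (ν j)) :
    ∃ s ∈ Submodule.span ℂ (ratVec J '' Set.Iio j),
      posOp (ν 0) (embed J j f) = embed J j (posOp (ν j) f) + s := by
  induction j with
  | zero => exact ⟨0, Submodule.zero_mem _, (add_zero _).symm⟩
  | succ j ih =>
    obtain ⟨s, hs, h⟩ := ih (J j f)
    obtain ⟨c, hc⟩ := (hJ j).compression f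
    refine ⟨c • ratVec J j + s, Submodule.add_mem _ (Submodule.smul_mem _ _
      (Submodule.subset_span ⟨j, Nat.lt_succ_self j, rfl⟩))
      (Submodule.span_mono (Set.image_mono (Set.Iio_subset_Iio (Nat.le_succ j))) hs), ?_⟩
    change posOp (ν 0) (embed J j (J j f)) = embed J j (J j (posOp (ν (j + 1)) f)) + _
    rw [h, hc, map_add, map_smul, ratVec, add_assoc]

lemma inner_embed_of_mem_span (hJ : ∀ j, IsStep (ν j) (ν (j + 1)) (w j) (J j)) {j : ℕ}
    (f : Lp ℂ 2 (ν j)) {s : Lp ℂ 2 (ν 0)} (hs : s ∈ Submodule.span ℂ (ratVec J '' Set.Iio j)) :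
    ⟪embed J j f, s⟫_ℂ = 0 := by
  have hle : Submodule.span ℂ (ratVec J '' Set.Iio j) ≤ (ℂ ∙ embed J j f)ᗮ := by
    rw [Submodule.span_le]
    rintro _ ⟨i, hi, rfl⟩
    rw [SetLike.mem_coe, Submodule.mem_orthogonal_singleton_iff_inner_right, ← inner_conj_symm,
      inner_ratVec_embed hJ hi, map_zero]
  exact Submodule.mem_orthogonal_singleton_iff_inner_right.1 (hle hs)

lemma inner_embed_posOp_embed (hJ : ∀ j, IsStep (ν j) (ν (j + 1)) (w j) (J j)) (j : ℕ)
    (f g : Lp ℂ 2 (ν j)) :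
    ⟪embed J j f, posOp (ν 0) (embed J j g)⟫_ℂ = ⟪f, posOp (ν j) g⟫_ℂ := by
  obtain ⟨s, hs, h⟩ := posOp_embed hJ j g
  rw [h, inner_add_right, inner_embed_of_mem_span hJ f hs, add_zero, LinearIsometry.inner_map_map]

variable {a b : ℝ}

/-- The embedded resolvent vectors satisfy `t r = w r` up to rational functions of index at most
`j`. -/
lemma posOp_embed_resVec (hJ : ∀ j, IsStep (ν j) (ν (j + 1)) (w j) (J j))
    (hν : ∀ j, ν j (Set.Icc a b)ᶜ = 0) (hw : ∀ j, w j ∉ cSegment a b) (j : ℕ) :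
    ∃ s ∈ Submodule.span ℂ (ratVec J '' Set.Iio (j + 1)),
      posOp (ν 0) (embed J j (resVec (ν j) (w j))) = w j • embed J j (resVec (ν j) (w j)) + s := by
  obtain ⟨s, hs, h⟩ := posOp_embed hJ j (resVec (ν j) (w j))
  refine ⟨s - (markov (ν j) (w j))⁻¹ • ratVec J j, Submodule.sub_mem _
    (Submodule.span_mono (Set.image_mono (Set.Iio_subset_Iio (Nat.le_succ j))) hs)
    (Submodule.smul_mem _ _ (Submodule.subset_span ⟨j, Nat.lt_succ_self j, rfl⟩)), ?_⟩
  rw [h, posOp_resVec (hν j) (hw j), map_sub, map_smul, map_smul, ratVec]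
  abel

lemma inner_embed_resVec_posOp_of_lt (hJ : ∀ j, IsStep (ν j) (ν (j + 1)) (w j) (J j))
    (hν : ∀ j, ν j (Set.Icc a b)ᶜ = 0) (hw : ∀ j, w j ∉ cSegment a b) {i j : ℕ} (hij : j < i) :
    ⟪embed J i (resVec (ν i) (w i)), posOp (ν 0) (embed J j (resVec (ν j) (w j)))⟫_ℂ =
      w j * ⟪embed J i (resVec (ν i) (w i)), embed J j (resVec (ν j) (w j))⟫_ℂ := by
  obtain ⟨s, hs, h⟩ := posOp_embed_resVec hJ hν hw j
  have hs' : s ∈ Submodule.span ℂ (ratVec J '' Set.Iio i) :=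
    Submodule.span_mono (Set.image_mono (Set.Iio_subset_Iio hij)) hs
  rw [h, inner_add_right, inner_smul_right, inner_embed_of_mem_span hJ _ hs', add_zero]

end Tower

/-! ### The pencil -/

lemma inner_bidiagonal {L : Ell2 →L[ℂ] Ell2} {c : ℕ → ℝ}
    (hL : ∀ j, L (e j) = e j + (c j : ℂ) • e (j + 1)) (i j : ℕ) :
    ⟪L (e i), L (e j)⟫_ℂ = if i = j then ((1 + c j ^ 2 : ℝ) : ℂ)
      else if i = j + 1 then (c j : ℂ) else if j = i + 1 then (c i : ℂ) else 0 := by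
  simp only [hL, inner_add_left, inner_add_right, inner_smul_left, inner_smul_right,
    orthonormal_iff_ite.1 orthonormal_e, Complex.conj_ofReal]
  rcases lt_trichotomy i j with h | rfl | h
  · have h1 : i ≠ j := h.ne
    have h2 : i ≠ j + 1 := by omega
    have h3 : (i + 1 = j) = (j = i + 1) := propext eq_comm
    have h4 : ¬ (i + 1 = j + 1) := by omega
    simp only [h1, h2, h3, h4, if_false]
    split_ifs <;> simp
  · have h2 : i ≠ i + 1 := by omega
    have h3 : i + 1 ≠ i := by omega
    simp only [h2, h3, if_true, if_false]
    push_cast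
    ring
  · have h1 : i ≠ j := h.ne'
    have h2 : ¬ (i + 1 = j) := by omega
    have h3 : ¬ (j = i + 1) := by omega
    have h4 : ¬ (i + 1 = j + 1) := by omega
    simp only [h1, h2, h3, h4, if_false]
    split_ifs <;> simp

/-- The off-diagonal entries tend to zero when the interpolation points tend to infinity. -/
lemma tendsto_offB {a b : ℝ} {ν : ℕ → Measure ℝ} [∀ j, IsProbabilityMeasure (ν j)]
    (hν : ∀ j, ν j (Set.Icc a b)ᶜ = 0) {w : ℕ → ℂ}
    (hlim : Tendsto w atTop (Bornology.cobounded ℂ)) :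
    Tendsto (fun j => offB (ν j) (w j)) atTop (𝓝 0) := by
  obtain ⟨M, hM, hb⟩ := exists_abs_bound a b
  have hnorm : Tendsto (fun j => ‖w j‖) atTop atTop := tendsto_norm_cobounded_atTop.comp hlim
  refine squeeze_zero' (Eventually.of_forall fun j => Real.sqrt_nonneg _) ?_
    (hnorm.const_div_atTop (6 * M))
  filter_upwards [hnorm.eventually_ge_atTop (3 * M)] with j hj using offB_le (hν j) hM hb hj

/-- The numerical range of `L† L` with `L` invertible stays away from zero. -/
lemma zero_notMem_closure_numericalRange {L : Ell2 →L[ℂ] Ell2} (hL : IsUnit L) :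
    (0 : ℂ) ∉ closure (numericalRange (ContinuousLinearMap.adjoint L ∘L L)) := by
  obtain ⟨u, rfl⟩ := hL
  set R : Ell2 →L[ℂ] Ell2 := ↑u⁻¹ with hR
  set κ : ℝ := ((‖R‖ + 1) ^ 2)⁻¹ with hκ
  have hκpos : 0 < κ := by positivity
  have hcl : IsClosed {c : ℂ | κ ≤ c.re} := isClosed_le continuous_const Complex.continuous_re
  have hsub : numericalRange (ContinuousLinearMap.adjoint (u : Ell2 →L[ℂ] Ell2) ∘L u) ⊆
      {c : ℂ | κ ≤ c.re} := by
    rintro _ ⟨y, hy, rfl⟩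
    rw [ContinuousLinearMap.comp_apply, ContinuousLinearMap.adjoint_inner_right]
    have h1 : (⟪(u : Ell2 →L[ℂ] Ell2) y, (u : Ell2 →L[ℂ] Ell2) y⟫_ℂ).re
        = ‖(u : Ell2 →L[ℂ] Ell2) y‖ ^ 2 := inner_self_eq_norm_sq (𝕜 := ℂ) _
    rw [Set.mem_ofPred_eq, h1]
    have h2 : R ((u : Ell2 →L[ℂ] Ell2) y) = y := by
      rw [← mul_apply_eq_comp, hR, u.inv_mul, one_apply_eq_self]
    have h3 : 1 ≤ (‖R‖ + 1) * ‖(u : Ell2 →L[ℂ] Ell2) y‖ := by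
      have h4 := R.le_opNorm ((u : Ell2 →L[ℂ] Ell2) y)
      rw [h2, hy] at h4
      nlinarith [norm_nonneg ((u : Ell2 →L[ℂ] Ell2) y)]
    rw [hκ, inv_le_iff_one_le_mul₀ (by positivity), ← mul_pow, mul_comm]
    exact one_le_pow₀ h3
  intro h
  have h0 : κ ≤ (0 : ℂ).re := closure_minimal hsub hcl h
  rw [Complex.zero_re] at h0
  exact hκpos.not_ge h0

section Pencil

variable {a b : ℝ} {ν : ℕ → Measure ℝ} [∀ j, IsProbabilityMeasure (ν j)]
  {J : ∀ j, Lp ℂ 2 (ν (j + 1)) →ₗᵢ[ℂ] Lp ℂ 2 (ν j)} {w : ℕ → ℂ}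
  {L : Ell2 →L[ℂ] Ell2} {U : Ell2 →ₗᵢ[ℂ] Lp ℂ 2 (ν 0)}

lemma map_bidiagonal_eq (hJ : ∀ j, IsStep (ν j) (ν (j + 1)) (w j) (J j))
    (hL : ∀ j, L (e j) = e j + (offB (ν j) (w j) : ℂ) • e (j + 1))
    (hU : ∀ j, U (e j) = ratVec J j) (j : ℕ) :
    U (L (e j)) = embed J j (resVec (ν j) (w j)) := by
  rw [hL, map_add, map_smul, hU, hU, embed_resVec hJ]

/-- The rational functions span a dense subspace of `L²(ν 0)`: the range of `U` is closed and
contains `1`, and since `L` is invertible it is invariant under multiplication by `t`. -/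
lemma surjective_of_isUnit (hJ : ∀ j, IsStep (ν j) (ν (j + 1)) (w j) (J j))
    (hν : ∀ j, ν j (Set.Icc a b)ᶜ = 0) (hw : ∀ j, w j ∉ cSegment a b)
    (hL : ∀ j, L (e j) = e j + (offB (ν j) (w j) : ℂ) • e (j + 1)) (hLu : IsUnit L)
    (hU : ∀ j, U (e j) = ratVec J j) : Function.Surjective U := by
  have hcl : IsClosed (LinearMap.range U.toLinearMap : Set (Lp ℂ 2 (ν 0))) :=
    U.isometry.isClosedEmbedding.isClosed_range
  have hspan : ∀ n, Submodule.span ℂ (ratVec J '' Set.Iio n) ≤ LinearMap.range U.toLinearMap := by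
    intro n
    rw [Submodule.span_le]
    rintro _ ⟨i, -, rfl⟩
    exact ⟨e i, hU i⟩
  have hTL : ∀ x, posOp (ν 0) (U (L x)) ∈ LinearMap.range U.toLinearMap := by
    let P : Ell2 →L[ℂ] Lp ℂ 2 (ν 0) := posOp (ν 0) ∘L U.toContinuousLinearMap ∘L L
    refine mem_of_forall_e_mem (M := (LinearMap.range U.toLinearMap).comap P.toLinearMap)
      (hcl.preimage P.continuous) fun j => ?_
    change posOp (ν 0) (U (L (e j))) ∈ LinearMap.range U.toLinearMap
    obtain ⟨s, hs, h⟩ := posOp_embed_resVec hJ hν hw j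
    rw [map_bidiagonal_eq hJ hL hU, h, ← map_bidiagonal_eq hJ hL hU]
    exact Submodule.add_mem _ (Submodule.smul_mem _ _ ⟨_, rfl⟩) (hspan _ hs)
  have htop := eq_top_of_invariant (hν 0) (LinearMap.range U.toLinearMap) hcl ⟨e 0, hU 0⟩ (by
    rintro _ ⟨x, rfl⟩
    obtain ⟨y, rfl⟩ := (ContinuousLinearMap.isUnit_iff_bijective.1 hLu).2 x
    exact hTL y)
  exact LinearMap.range_eq_top.1 htop

/-- The pencil attached to a sequence of steps, realized as `z B - A = L† U† (z - t) U L` with `U`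
unitary and `L` invertible. -/
lemma exists_pencil (hJ : ∀ j, IsStep (ν j) (ν (j + 1)) (w j) (J j))
    (hν : ∀ j, ν j (Set.Icc a b)ᶜ = 0) (hw : ∀ j, w j ∉ cSegment a b)
    (hlim : Tendsto w atTop (Bornology.cobounded ℂ)) {z : ℕ → ℂ}
    (hz : ∀ j, z (2 * j + 1) = w j) (hz' : ∀ j, z (2 * j + 2) = conj (w j)) :
    ∃ A B : Ell2 →L[ℂ] Ell2, Represents A (matA z ν) ∧ Represents B (matB z ν) ∧
      IsCompactOperator (B - ContinuousLinearMap.id ℂ Ell2) ∧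
      (0 : ℂ) ∉ closure (numericalRange B) ∧
      pencilSpectrum A B = (fun t : ℝ => (t : ℂ)) '' (ν 0).support ∧
      ∀ ζ : ℂ, ζ ∉ pencilSpectrum A B → markov (ν 0) ζ = mFunction A B ζ := by
  obtain ⟨W, hW, hWc, hWc'⟩ := exists_weightedShift (tendsto_offB hν hlim)
  obtain ⟨U₀, hU₀⟩ := exists_linearIsometry_of_orthonormal (orthonormal_ratVec hJ)
  set L : Ell2 →L[ℂ] Ell2 := 1 + W with hLdef
  have hL : ∀ j, L (e j) = e j + (offB (ν j) (w j) : ℂ) • e (j + 1) := fun j => by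
    rw [hLdef, _root_.add_apply, one_apply_eq_self, hW]
  have hLu : IsUnit L := isUnit_one_add_weightedShift hW hWc
  let U : Ell2 ≃ₗᵢ[ℂ] Lp ℂ 2 (ν 0) :=
    LinearIsometryEquiv.ofSurjective U₀ (surjective_of_isUnit hJ hν hw hL hLu hU₀)
  have hU : ∀ j, U (e j) = ratVec J j := hU₀
  have hUL : ∀ j, U (L (e j)) = embed J j (resVec (ν j) (w j)) := map_bidiagonal_eq hJ hL hU₀
  have hUsymm : ∀ (x : Ell2) (f : Lp ℂ 2 (ν 0)), ⟪x, U.symm f⟫_ℂ = ⟪U x, f⟫_ℂ := fun x f => by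
    rw [← U.inner_map_map, U.apply_symm_apply]
  set Ls := ContinuousLinearMap.adjoint L with hLs
  have hLs_inner : ∀ x y, ⟪x, Ls y⟫_ℂ = ⟪L x, y⟫_ℂ := fun x y =>
    ContinuousLinearMap.adjoint_inner_right L x y
  let T : Ell2 →L[ℂ] Ell2 := U.symm.toContinuousLinearEquiv.toContinuousLinearMap ∘L
    posOp (ν 0) ∘L U.toContinuousLinearEquiv.toContinuousLinearMap
  let A : Ell2 →L[ℂ] Ell2 := Ls ∘L T ∘L L
  let B : Ell2 →L[ℂ] Ell2 := Ls ∘L L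
  have hpencil : ∀ (ζ : ℂ) x, (ζ • B - A) x = Ls (U.symm ((ζ • 1 - posOp (ν 0)) (U (L x)))) := by
    intro ζ x
    have h1 : U.symm ((ζ • 1 - posOp (ν 0)) (U (L x)))
        = ζ • L x - U.symm (posOp (ν 0) (U (L x))) := by
      rw [_root_.sub_apply, _root_.smul_apply, one_apply_eq_self, map_sub, map_smul,
        U.symm_apply_apply]
    rw [h1, map_sub, map_smul]
    rfl
  -- Row `0` of `L` is that of the identity, so `e 0` is fixed by the adjoint of `L`.
  have hLe0 : Ls (e 0) = e 0 := by
    refine ext_inner_left ℂ fun x => ?_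
    rw [hLs_inner]
    have h1 : ∀ y, ⟪e 0, L y⟫_ℂ = ⟪e 0, y⟫_ℂ := fun y => by
      have h2 : (innerSL ℂ (e 0) ∘L L - innerSL ℂ (e 0)) y = 0 := by
        refine mem_of_forall_e_mem
          (M := LinearMap.ker (innerSL ℂ (e 0) ∘L L - innerSL ℂ (e 0)).toLinearMap)
          (innerSL ℂ (e 0) ∘L L - innerSL ℂ (e 0)).isClosed_ker (fun j => ?_) y
        change ⟪e 0, L (e j)⟫_ℂ - ⟪e 0, e j⟫_ℂ = 0
        rw [hL, inner_add_right, inner_smul_right, orthonormal_e.2 (Nat.succ_ne_zero j).symm]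
        simp
      exact sub_eq_zero.1 h2
    rw [← inner_conj_symm, h1, inner_conj_symm]
  have hLbij := ContinuousLinearMap.isUnit_iff_bijective.1 hLu
  have hLsbij : Function.Bijective Ls := by
    refine ContinuousLinearMap.isUnit_iff_bijective.1 ?_
    rw [hLs, ← ContinuousLinearMap.star_eq_adjoint]
    exact hLu.star
  have hspec : pencilSpectrum A B = (fun t : ℝ => (t : ℂ)) '' (ν 0).support := by
    ext ζ
    rw [← not_iff_not, ← isUnit_sub_posOp_iff (hν 0) ζ]
    change ¬ ¬ IsUnit (ζ • B - A) ↔ _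
    rw [not_not, ContinuousLinearMap.isUnit_iff_bijective,
      ContinuousLinearMap.isUnit_iff_bijective]
    have h1 : ⇑(ζ • B - A) = Ls ∘ U.symm ∘ ⇑(ζ • 1 - posOp (ν 0)) ∘ U ∘ L :=
      funext (hpencil ζ)
    rw [h1, hLsbij.of_comp_iff', U.symm.bijective.of_comp_iff',
      Function.Bijective.of_comp_iff _ (U.bijective.comp hLbij)]
  refine ⟨A, B, fun x i => ?_, fun x i => ?_, ?_, zero_notMem_closure_numericalRange hLu, hspec,
    fun ζ hζ => ?_⟩
  · convert hasSum_entries A x i using 3 with j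
    have h1 : ⟪e i, A (e j)⟫_ℂ = ⟪U (L (e i)), posOp (ν 0) (U (L (e j)))⟫_ℂ := by
      change ⟪e i, Ls (U.symm (posOp (ν 0) (U (L (e j)))))⟫_ℂ = _
      rw [hLs_inner, hUsymm]
    have hlt : ∀ {i j : ℕ}, j < i → ⟪U (L (e i)), posOp (ν 0) (U (L (e j)))⟫_ℂ
        = if i = j + 1 then (offB (ν j) (w j) : ℂ) * w j else 0 := by
      intro i j hij
      rw [hUL, hUL, inner_embed_resVec_posOp_of_lt hJ hν hw hij, ← hUL, ← hUL, U.inner_map_map,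
        inner_bidiagonal hL, if_neg hij.ne', if_neg (by omega : ¬ j = i + 1), mul_comm, ite_mul,
        zero_mul]
    rw [h1, matA]
    simp only [hz, hz']
    rcases lt_trichotomy i j with h | rfl | h
    · rw [← inner_posOp_left (hν 0), ← inner_conj_symm, hlt h, if_neg h.ne,
        if_neg (by omega : ¬ i = j + 1)]
      split_ifs <;> simp
    · rw [if_pos rfl, hUL, inner_embed_posOp_embed hJ, inner_resVec_posOp (hν i) (hw i)]
    · rw [hlt h, if_neg h.ne', if_neg (by omega : ¬ j = i + 1)]
  · convert hasSum_entries B x i using 3 with j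
    have h1 : ⟪e i, B (e j)⟫_ℂ = ⟪L (e i), L (e j)⟫_ℂ := hLs_inner _ _
    rw [h1, inner_bidiagonal hL, matB]
    simp only [hz, one_add_offB_sq (hν _) (hw _)]
  · have h1 : B - ContinuousLinearMap.id ℂ Ell2
        = W + ContinuousLinearMap.adjoint W + ContinuousLinearMap.adjoint W ∘L W := by
      have h2 : Ls = 1 + ContinuousLinearMap.adjoint W := by
        rw [hLs, hLdef, map_add, ← ContinuousLinearMap.star_eq_adjoint, star_one]
      change Ls * L - 1 = W + ContinuousLinearMap.adjoint W + ContinuousLinearMap.adjoint W * W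
      rw [h2, hLdef]
      noncomm_ring
    rw [h1]
    exact (hWc.add hWc').add (hWc.clm_comp (ContinuousLinearMap.adjoint W))
  · have hunit : IsUnit (ζ • B - A) := by
      by_contra h
      exact hζ h
    rw [hspec] at hζ
    obtain ⟨x, hx⟩ := hLbij.2 (U.symm (resOp (ν 0) ζ (one (ν 0))))
    have hPx : (ζ • B - A) x = e 0 := by
      have h1 : (ζ • 1 - posOp (ν 0)) (resOp (ν 0) ζ (one (ν 0))) = one (ν 0) := by
        rw [← mul_apply_eq_comp, mul_resOp (hν 0) hζ, one_apply_eq_self]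
      have h2 : U.symm (one (ν 0)) = e 0 := by
        rw [U.symm_apply_eq, hU]
        rfl
      rw [hpencil, hx, U.apply_symm_apply, h1, h2, hLe0]
    have hinv : Ring.inverse (ζ • B - A) (e 0) = x := by
      rw [← hPx, ← mul_apply_eq_comp, Ring.inverse_mul_cancel _ hunit, one_apply_eq_self]
    have hU0 : U (e 0) = one (ν 0) := hU 0
    rw [mFunction, hinv, ← hLe0, ← inner_conj_symm, hLs_inner, inner_conj_symm, hx, hUsymm, hU0,
      inner_one_resOp_one hζ]

end Pencil

end MarkovPencil

theorem theorem5p4 (a b : ℝ) (μ : Measure ℝ) [IsProbabilityMeasure μ]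
    (hμ : μ (Set.Icc a b)ᶜ = 0) (hinf : μ.support.Infinite)
    (z : ℕ → ℂ) (δ : ℝ) (hδ : 0 < δ)
    (hconj : ∀ j : ℕ, z (2 * j + 1) = (starRingEnd ℂ) (z (2 * j + 2)))
    (hdist : ∀ j : ℕ, 1 ≤ j → δ < Metric.infDist (z j) (MarkovPencil.cSegment a b))
    (hlim : Tendsto (fun j : ℕ => z (2 * j + 1)) atTop (Bornology.cobounded ℂ)) :
    (∃ ν : ℕ → Measure ℝ, MarkovPencil.IsThieleExpansion a b μ z ν) ∧
    ∀ ν : ℕ → Measure ℝ, MarkovPencil.IsThieleExpansion a b μ z ν →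
      ∃ A B : MarkovPencil.Ell2 →L[ℂ] MarkovPencil.Ell2,
        MarkovPencil.Represents A (MarkovPencil.matA z ν) ∧
        MarkovPencil.Represents B (MarkovPencil.matB z ν) ∧
        IsCompactOperator (B - ContinuousLinearMap.id ℂ MarkovPencil.Ell2) ∧
        (0 : ℂ) ∉ closure (MarkovPencil.numericalRange B) ∧
        MarkovPencil.pencilSpectrum A B = (fun t : ℝ => (t : ℂ)) '' μ.support ∧
        ∀ ζ : ℂ, ζ ∉ MarkovPencil.pencilSpectrum A B →
          MarkovPencil.markov μ ζ = MarkovPencil.mFunction A B ζ := by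
  have hz : ∀ j, z (2 * j + 2) = (starRingEnd ℂ) (z (2 * j + 1)) := fun j => by
    rw [hconj, RCLike.conj_conj]
  have hw : ∀ j, z (2 * j + 1) ∉ MarkovPencil.cSegment a b := by
    intro j h
    have h1 := hdist (2 * j + 1) (by omega)
    rw [Metric.infDist_zero_of_mem h] at h1
    exact h1.not_gt hδ
  have hdim := MarkovPencil.infiniteDimensional_of_infinite_support hμ hinf
  constructor
  · let P : Measure ℝ → Prop := fun ρ =>
      IsProbabilityMeasure ρ ∧ ρ (Set.Icc a b)ᶜ = 0 ∧ ¬ FiniteDimensional ℂ (Lp ℂ 2 ρ)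
    have hstep : ∀ (j : ℕ) (ρ : {ρ // P ρ}), ∃ ρ' : {ρ // P ρ}, ∀ ζ : ℂ,
        ζ ∉ MarkovPencil.cSegment a b → MarkovPencil.markov ρ.1 ζ =
          1 / (ζ * (MarkovPencil.diagB ρ.1 (z (2 * j + 1)) : ℂ)
            - (MarkovPencil.diagA ρ.1 (z (2 * j + 1)) : ℂ)
            - (MarkovPencil.offB ρ.1 (z (2 * j + 1)) : ℂ) ^ 2 * (ζ - z (2 * j + 1))
              * (ζ - z (2 * j + 2)) * MarkovPencil.markov ρ'.1 ζ) := by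
      rintro j ⟨ρ, hprob, hρ, hρdim⟩
      obtain ⟨ρ', hprob', hρ', J, hJ⟩ := MarkovPencil.exists_isStep hρ (hw j) hρdim
      refine ⟨⟨ρ', hprob', hρ', hJ.infiniteDimensional hρ (hw j) hρdim⟩, fun ζ hζ => ?_⟩
      rw [hz]
      exact hJ.recurrence hρ hρ' (hw j) hζ
    choose next hnext using hstep
    let s : ℕ → {ρ // P ρ} := fun j => Nat.rec ⟨μ, inferInstance, hμ, hdim⟩ next j
    exact ⟨fun j => (s j).1, rfl, fun j => (s j).2.1, fun j => (s j).2.2.1,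
      fun j => hnext j (s j)⟩
  · rintro ν ⟨rfl, hprob, hν, hrec⟩
    have hstep : ∀ j, ¬ FiniteDimensional ℂ (Lp ℂ 2 (ν j)) →
        ∃ J : Lp ℂ 2 (ν (j + 1)) →ₗᵢ[ℂ] Lp ℂ 2 (ν j),
          MarkovPencil.IsStep (ν j) (ν (j + 1)) (z (2 * j + 1)) J := fun j hj =>
      MarkovPencil.exists_isStep_of_recurrence (hν j) (hν (j + 1)) (hw j) hj fun ζ hζ => by
        rw [← hz]
        exact hrec j ζ hζ
    have hdims : ∀ j, ¬ FiniteDimensional ℂ (Lp ℂ 2 (ν j)) := by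
      intro j
      induction j with
      | zero => exact hdim
      | succ j ih =>
        obtain ⟨J, hJ⟩ := hstep j ih
        exact hJ.infiniteDimensional (hν j) (hw j) ih
    choose J hJ using fun j => hstep j (hdims j)
    exact MarkovPencil.exists_pencil hJ hν hw hlim (fun _ => rfl) hz
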